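/- All homology is singular homology with coefficients in $\mathbb{R}$; $\widetilde H_j(Y)$ denotes reduced homology, $\widetilde H_j(Y)=\ker\bigl(H_j(Y)\to H_j(\mathrm{pt})\bigr)$, $j\ge 0$. Let $L$ be a simply connected smooth manifold (without boundary, not necessarily compact) of dimension $l$, let $X=c^\circ(L)=\bigl((0,1]\times L\bigr)/\bigl((1,x)\sim(1,x')\bigr)$ be the open cone on $L$, let $\bar p$ be an extended perversity, that is, any sequence of integers, and put $k=l-\bar p(l+1)\in\mathbb{Z}$. Let $f\colon L_{<k}\to L$ be a stage $k$ Moore approximation of $L$, that is, a continuous map from a topological space $L_{<k}$ such that $f_*\colon H_i(L_{<k})\to H_i(L)$ is an isomorphism for all $i<k$, and $H_i(L_{<k})=0$ for all $i\ge k$. The intersection space of $X$ built from $f$ is the quotient space $$I^{\bar p}X=\frac{\bigl(L\times[0,1)\bigr)\sqcup c(L_{<k})}{(f(x),0)\sim[0,x]\ \ (x\in L_{<k})},\qquad c(L_{<k})=\frac{[0,1]\times L_{<k}}{(1,x)\sim(1,x')},$$ (so $c(\varnothing)=\varnothing$), where $L\times[0,1)$ is the blow-up of $X$ at its vertex. Then,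 for every integer $j\ge 0$, $$\widetilde H_j(I^{\bar p}X)\cong\begin{cases}0 & \text{if } 0<j<l-\bar p(l+1),\\ \widetilde H_j(L) & \text{otherwise.}\end{cases}$$ -/

import Mathlib

open scoped Manifold ContDiff

universe u

/-- An extended perversity: a sequence of integers, with no further condition. -/
abbrev ExtendedPerversity : Type := ℕ → ℤ

noncomputable section

/-- Singular homology with real coefficients (`ULift ℝ` is a copy of `ℝ` in the universe of the
spaces). -/
def singularHomologyReal (n : ℕ) :
    CategoryTheory.Functor TopCat.{u} (ModuleCat.{u} ℝ) :=
  (AlgebraicTopology.singularHomologyFunctor (ModuleCat.{u} ℝ) n).obj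
    (ModuleCat.of ℝ (ULift.{u} ℝ))

/-- `H_n(X; ℝ)`. -/
abbrev Homology (n : ℕ) (X : Type u) [TopologicalSpace X] : ModuleCat.{u} ℝ :=
  (singularHomologyReal n).obj (TopCat.of X)

/-- The map `f_* : H_n(X; ℝ) → H_n(Y; ℝ)` induced by a continuous map `f`. -/
def Homology.map (n : ℕ) {X Y : Type u} [TopologicalSpace X] [TopologicalSpace Y] (f : C(X, Y)) :
    Homology n X →ₗ[ℝ] Homology n Y :=
  ((singularHomologyReal n).map (TopCat.ofHom f)).hom

/-- The reduced singular homology of `X` with real coefficients in degree `n`: the kernel of the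
map to the homology of a point. -/
def ReducedHomology (n : ℕ) (X : Type u) [TopologicalSpace X] : Submodule ℝ (Homology n X) :=
  LinearMap.ker (Homology.map n (ContinuousMap.const X PUnit.unit.{u + 1}))

/-- `f : A → L` is a stage `k` Moore approximation of `L`: `f_* : H_i(A) → H_i(L)` is an
isomorphism for `i < k`, and `H_i(A) = 0` for `i ≥ k`. -/
structure IsMooreApproximation (k : ℤ) {A L : Type u} [TopologicalSpace A] [TopologicalSpace L]
    (f : C(A, L)) : Prop where
  bijective_of_lt : ∀ i : ℕ, (i : ℤ) < k → Function.Bijective (Homology.map i f)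
  subsingleton_of_le : ∀ i : ℕ, k ≤ (i : ℤ) → Subsingleton (Homology i A)

end

/-- The relation on `[0,1] × A` that identifies all points `(1, x)`. -/
inductive ConeRel (A : Type u) : unitInterval × A → unitInterval × A → Prop
  | vertex (x x' : A) : ConeRel A (1, x) (1, x')

/-- The closed cone `c(A) = ([0,1] × A) / ((1, x) ∼ (1, x'))`, with the quotient topology. -/
abbrev ClosedCone (A : Type u) [TopologicalSpace A] : Type u := Quot (ConeRel A)

/-- The relation on `(L × [0,1)) ⊔ c(A)` that identifies `(f(x), 0)` with the point `(0, x)` of the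
base of the cone. -/
inductive GluingRel {A L : Type u} [TopologicalSpace A] [TopologicalSpace L] (f : C(A, L)) :
    (L × Set.Ico (0 : ℝ) 1) ⊕ ClosedCone A → (L × Set.Ico (0 : ℝ) 1) ⊕ ClosedCone A → Prop
  | glue (x : A) :
      GluingRel f (Sum.inl (f x, ⟨0, le_rfl, one_pos⟩)) (Sum.inr (Quot.mk _ (0, x)))

/-- The intersection space of the open cone on `L` built from the Moore approximation
`f : A → L`: the blow-up `L × [0,1)` of the open cone at its vertex, with the cone on `A` glued to
its boundary `L × {0}` along `f`. It carries the quotient topology. -/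
abbrev IntersectionSpace {A L : Type u} [TopologicalSpace A] [TopologicalSpace L] (f : C(A, L)) :
    Type u := Quot (GluingRel f)

/-! Up to an open collar, the intersection space is the mapping cone of `f`. The cone coordinate,
extended by `0` over the collar, defines the open sets `upper` (height above `1/3`) and `lower`
(height below `2/3`). The first contracts to the cone vertex, or is empty when `A` is. The second
retracts onto `L`, their intersection is homotopy equivalent to `A`, and under these equivalences
the inclusion of the intersection into `lower` becomes `f`. Mayer–Vietoris thus gives, in positive
degrees, H_{n+1}(A) → H_{n+1}(L) → H_{n+1}(IX) → H_n(A) → H_n(L).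

A Moore approximation is injective on homology in every degree: below `k` it is an isomorphism, and
from `k` on its source vanishes. Hence H_{n+1}(L) → H_{n+1}(IX) is always onto. If n + 1 < k, then
`f` is also onto in degree n + 1, so every class comes from the intersection, factors through
`upper`, and is zero. If n + 1 ≥ k, then H_{n+1}(A) = 0 and the map is also injective. In degree 0
both reduced groups vanish by path connectedness.

Only two fragments of Mayer–Vietoris exactness are needed, `Homology.map_incl_surjective` and
`Homology.map_incl_injective`. Both are chain-level arguments from the small chains theorem
`SingularChain.exists_eq_add_add_boundary`, which rests on barycentric subdivision of formal tuples
of points in a simplex. -/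

section SingularComplex

/-! ### Singular chains with an explicit basis of simplices. -/

open CategoryTheory AlgebraicTopology Simplicial

/-- The singular chain complex of `X` with real coefficients. -/
noncomputable abbrev singularComplex (X : Type u) [TopologicalSpace X] :
    ChainComplex (ModuleCat.{u} ℝ) ℕ :=
  (TopCat.toSSet.obj (TopCat.of X)).chainComplex (ModuleCat.of ℝ (ULift.{u} ℝ))

/-- The map of singular chain complexes induced by a continuous map. -/
noncomputable abbrev singularComplexMap {X Y : Type u} [TopologicalSpace X] [TopologicalSpace Y]
    (f : C(X, Y)) : singularComplex X ⟶ singularComplex Y :=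
  SSet.chainComplexMap (TopCat.toSSet.map (TopCat.ofHom f)) _

/-- The topological simplex of dimension `n`. -/
abbrev TopSimplex (n : ℕ) : Type := stdSimplex ℝ (Fin (n + 1))

/-- The module of singular `n`-chains of `X` with real coefficients. -/
noncomputable def SingularChain (n : ℕ) (X : Type u) [TopologicalSpace X] : Type u :=
  (singularComplex X).X n

noncomputable instance SingularChain.instAddCommGroup (n : ℕ) (X : Type u) [TopologicalSpace X] :
    AddCommGroup (SingularChain n X) :=
  inferInstanceAs (AddCommGroup ((singularComplex X).X n))

noncomputable instance SingularChain.instModule (n : ℕ) (X : Type u) [TopologicalSpace X] :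
    Module ℝ (SingularChain n X) :=
  inferInstanceAs (Module ℝ ((singularComplex X).X n))

/-- The basis of a coproduct of copies of `ℝ` indexed by the summands. -/
noncomputable def coproductBasis (I : Type u) :
    Module.Basis I ℝ (∐ fun _ : I ↦ ModuleCat.of ℝ (ULift.{u} ℝ) : ModuleCat.{u} ℝ) := by
  classical
  exact Module.Basis.ofRepr
    (((ModuleCat.coprodIsoDirectSum (R := ℝ)
      (fun _ : I ↦ ModuleCat.of ℝ (ULift.{u} ℝ))).toLinearEquiv.trans
      (finsuppLEquivDirectSum ℝ (ULift.{u} ℝ) I).symm).trans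
      (Finsupp.mapRange.linearEquiv ULift.moduleEquiv))

lemma coproductBasis_apply {I : Type u} (i : I) :
    coproductBasis I i =
      (Limits.Sigma.ι (fun _ : I ↦ ModuleCat.of ℝ (ULift.{u} ℝ)) i).hom ⟨1⟩ := by
  classical
  rw [Module.Basis.apply_eq_iff]
  have h := congr(($(ModuleCat.ι_coprodIsoDirectSum_hom
    (fun _ : I ↦ ModuleCat.of ℝ (ULift.{u} ℝ)) i)).hom ⟨1⟩)
  have h' : (ModuleCat.coprodIsoDirectSum (R := ℝ)
      (fun _ : I ↦ ModuleCat.of ℝ (ULift.{u} ℝ))).toLinearEquiv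
      ((Limits.Sigma.ι (fun _ : I ↦ ModuleCat.of ℝ (ULift.{u} ℝ)) i).hom ⟨1⟩) =
      DirectSum.lof ℝ I (fun _ ↦ ULift.{u} ℝ) i ⟨1⟩ := h
  simp only [coproductBasis, LinearEquiv.trans_apply]
  rw [h']
  have : (finsuppLEquivDirectSum ℝ (ULift.{u} ℝ) I).symm
      (DirectSum.lof ℝ I (fun _ ↦ ULift.{u} ℝ) i ⟨1⟩) = Finsupp.single i ⟨1⟩ :=
    finsuppLEquivDirectSum_symm_lof ..
  rw [this]
  rw [Finsupp.mapRange.linearEquiv_apply, Finsupp.mapRange_single]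
  rfl

lemma ModuleCat.hom_sum_neg_one_pow_smul_apply {M N : ModuleCat.{u} ℝ} {k : ℕ}
    (φ : Fin k → (M ⟶ N)) (x : M) :
    (∑ i : Fin k, (-1 : ℤ) ^ (i : ℕ) • φ i).hom x =
      ∑ i : Fin k, (-1 : ℝ) ^ (i : ℕ) • (φ i).hom x := by
  rw [ModuleCat.hom_sum, LinearMap.sum_apply]
  refine Finset.sum_congr rfl fun i _ ↦ ?_
  rcases Nat.even_or_odd (i : ℕ) with h | h <;> simp [h.neg_one_pow]

namespace SingularChain

variable {X Y Z : Type u} [TopologicalSpace X] [TopologicalSpace Y] [TopologicalSpace Z] {n : ℕ}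

/-- The boundary operator on singular chains. -/
noncomputable def boundary (n : ℕ) (X : Type u) [TopologicalSpace X] :
    SingularChain (n + 1) X →ₗ[ℝ] SingularChain n X :=
  ((singularComplex X).d (n + 1) n).hom

/-- The map on singular chains induced by a continuous map. -/
noncomputable def push (n : ℕ) (f : C(X, Y)) : SingularChain n X →ₗ[ℝ] SingularChain n Y :=
  ((singularComplexMap f).f n).hom

/-- The basis of the module of singular chains given by the singular simplices. -/
noncomputable def basis (n : ℕ) (X : Type u) [TopologicalSpace X] :
    Module.Basis C(TopSimplex n, X) ℝ (SingularChain n X) := by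
  have b := (coproductBasis ((TopCat.toSSet.obj (TopCat.of X)).obj (.op ⦋n⦌))).reindex
    (TopCat.toSSetObjEquiv (TopCat.of X) (.op ⦋n⦌))
  exact b

lemma basis_apply (σ : C(TopSimplex n, X)) :
    basis n X σ = (SSet.ιChainComplex (TopCat.toSSet.obj (TopCat.of X))
      (R := ModuleCat.of ℝ (ULift.{u} ℝ))
      ((TopCat.toSSetObjEquiv (TopCat.of X) (.op ⦋n⦌)).symm σ)).hom ⟨1⟩ := by
  have h := (Module.Basis.reindex_apply
    (coproductBasis ((TopCat.toSSet.obj (TopCat.of X)).obj (.op ⦋n⦌)))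
    (TopCat.toSSetObjEquiv (TopCat.of X) (.op ⦋n⦌)) σ).trans (coproductBasis_apply _)
  exact h

/-- The inclusion of the `i`-th face. -/
noncomputable def face (i : Fin (n + 2)) : C(TopSimplex n, TopSimplex (n + 1)) :=
  ⟨stdSimplex.map i.succAbove, stdSimplex.continuous_map _⟩

/-- With `push_basis`, this replaces the categorical complex by the classical formulas, so that
later identities can be checked on simplices. -/
lemma boundary_basis (σ : C(TopSimplex (n + 1), X)) :
    boundary n X (basis (n + 1) X σ) =
      ∑ i : Fin (n + 2), (-1 : ℝ) ^ (i : ℕ) • basis n X (σ.comp (face i)) := by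
  simp_rw [basis_apply]
  exact (congr(($(SSet.ιChainComplex_d (TopCat.toSSet.obj (TopCat.of X))
    (ModuleCat.of ℝ (ULift.{u} ℝ))
    ((TopCat.toSSetObjEquiv (TopCat.of X) (.op ⦋n + 1⦌)).symm σ))).hom ⟨1⟩)).trans
    (ModuleCat.hom_sum_neg_one_pow_smul_apply _ _)

lemma push_basis (f : C(X, Y)) (σ : C(TopSimplex n, X)) :
    push n f (basis n X σ) = basis n Y (f.comp σ) := by
  rw [basis_apply, basis_apply]
  have := congr(($(SSet.ι_chainComplexMap_f _ _ (TopCat.toSSet.map (TopCat.ofHom f))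
    (ModuleCat.of ℝ (ULift.{u} ℝ))
    ((TopCat.toSSetObjEquiv (TopCat.of X) (.op ⦋n⦌)).symm σ))).hom ⟨1⟩)
  refine Eq.trans this ?_
  rfl

lemma boundary_boundary (c : SingularChain (n + 2) X) :
    boundary n X (boundary (n + 1) X c) = 0 :=
  congr(($((singularComplex X).d_comp_d (n + 2) (n + 1) n)).hom c)

lemma boundary_push (f : C(X, Y)) (c : SingularChain (n + 1) X) :
    boundary n Y (push (n + 1) f c) = push n f (boundary n X c) :=
  congr(($(HomologicalComplex.Hom.comm (singularComplexMap f) (n + 1) n)).hom c)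

lemma push_comp (g : C(Y, Z)) (f : C(X, Y)) : push n (g.comp f) = push n g ∘ₗ push n f :=
  (basis n X).ext fun σ ↦ by simp [push_basis, ContinuousMap.comp_assoc]

end SingularChain

/-! ### Cycles, homology classes, and chain-level criteria. -/

namespace SingularChain

variable {X Y Z : Type u} [TopologicalSpace X] [TopologicalSpace Y] [TopologicalSpace Z] {n : ℕ}

/-- A singular chain is a cycle if all differentials of the singular complex vanish on it. -/
def IsCycle (z : SingularChain n X) : Prop :=
  ∀ m, ((singularComplex X).d n m).hom z = 0

lemma isCycle_succ_iff {z : SingularChain (n + 1) X} : IsCycle z ↔ boundary n X z = 0 := by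
  refine ⟨fun h ↦ h n, fun h m ↦ ?_⟩
  by_cases hm : m = n
  · subst hm
    exact h
  · rw [(singularComplex X).shape _ _ (by simpa using fun h ↦ hm h)]
    rfl

lemma isCycle_boundary (w : SingularChain (n + 1) X) : IsCycle (boundary n X w) := fun m ↦
  congr(($((singularComplex X).d_comp_d (n + 1) n m)).hom w)

lemma d_push (f : C(X, Y)) (z : SingularChain n X) (m : ℕ) :
    ((singularComplex Y).d n m).hom (push n f z) =
      push m f (((singularComplex X).d n m).hom z) :=
  congr(($(HomologicalComplex.Hom.comm (singularComplexMap f) n m)).hom z)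

/-- An injective chain map reflects cycles. In the Mayer–Vietoris arguments this shows that a chain
of `U ∩ V` which bounds in `U` is a cycle. -/
lemma IsCycle.of_push {f : C(X, Y)} (hf : ∀ m, Function.Injective (SingularChain.push m f))
    {z : SingularChain n X} (hz : IsCycle (SingularChain.push n f z)) : IsCycle z := fun m ↦
  hf m (((d_push f z m).symm.trans (hz m)).trans (map_zero (SingularChain.push m f)).symm)

/-- The chain `z` is a cycle which represents the homology class `x`. -/
def Represents (z : SingularChain n X) (x : Homology n X) : Prop :=
  ∃ c : (singularComplex X).cycles n, ((singularComplex X).iCycles n).hom c = z ∧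
    ((singularComplex X).homologyπ n).hom c = x

lemma exists_represents (x : Homology n X) : ∃ z : SingularChain n X, Represents z x := by
  obtain ⟨c, hc⟩ := (ModuleCat.epi_iff_surjective ((singularComplex X).homologyπ n)).1
    inferInstance x
  exact ⟨_, c, rfl, hc⟩

lemma Represents.isCycle {z : SingularChain n X} {x : Homology n X} (h : Represents z x) :
    IsCycle z := fun m ↦ by
  obtain ⟨c, rfl, -⟩ := h
  exact congr(($((singularComplex X).iCycles_d n m)).hom c)

lemma IsCycle.exists_represents {z : SingularChain n X} (h : IsCycle z) :
    ∃ x : Homology n X, Represents z x := by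
  have he := (ShortComplex.moduleCat_exact_iff _).1
    ((ShortComplex.exact_of_f_is_kernel (ShortComplex.mk _ _ ((singularComplex X).iCycles_d n _)))
      ((singularComplex X).cyclesIsKernel n _ rfl)) z (h _)
  obtain ⟨c, hc⟩ := he
  exact ⟨_, c, hc, rfl⟩

/-- Homology is the cokernel of the differential into the cycles, and cycles embed in chains. -/
lemma Represents.eq_zero_iff {z : SingularChain n X} {x : Homology n X} (h : Represents z x) :
    x = 0 ↔ ∃ w, boundary n X w = z := by
  obtain ⟨c, rfl, rfl⟩ := h
  constructor
  · intro hx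
    obtain ⟨w, hw⟩ := (ShortComplex.moduleCat_exact_iff _).1
      ((ShortComplex.exact_of_g_is_cokernel
        (ShortComplex.mk _ _ ((singularComplex X).toCycles_comp_homologyπ (n + 1) n)))
        ((singularComplex X).homologyIsCokernel (n + 1) n (by simp))) c hx
    refine ⟨w, ?_⟩
    rw [← hw]
    exact congr(($((singularComplex X).toCycles_i (n + 1) n)).hom w).symm
  · rintro ⟨w, hw⟩
    have : c = ((singularComplex X).toCycles (n + 1) n).hom w := by
      refine (ModuleCat.mono_iff_injective ((singularComplex X).iCycles n)).1 inferInstance ?_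
      exact hw.symm.trans congr(($((singularComplex X).toCycles_i (n + 1) n)).hom w).symm
    rw [this]
    exact congr(($((singularComplex X).toCycles_comp_homologyπ (n + 1) n)).hom w)

lemma Represents.map {z : SingularChain n X} {x : Homology n X} (h : Represents z x)
    (f : C(X, Y)) : Represents (push n f z) (Homology.map n f x) := by
  obtain ⟨c, rfl, rfl⟩ := h
  refine ⟨(HomologicalComplex.cyclesMap (singularComplexMap f) n).hom c, ?_, ?_⟩
  · exact congr(($(HomologicalComplex.cyclesMap_i (singularComplexMap f) n)).hom c)
  · exact congr(($(HomologicalComplex.homologyπ_naturality (singularComplexMap f) n)).hom c).symm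

lemma Represents.sub {z z' : SingularChain n X} {x x' : Homology n X} (h : Represents z x)
    (h' : Represents z' x') : Represents (z - z') (x - x') := by
  obtain ⟨c, rfl, rfl⟩ := h
  obtain ⟨c', rfl, rfl⟩ := h'
  exact ⟨c - c', map_sub ((singularComplex X).iCycles n).hom c c',
    map_sub ((singularComplex X).homologyπ n).hom c c'⟩

end SingularChain

namespace Homology

open SingularChain

variable {X Y Z : Type u} [TopologicalSpace X] [TopologicalSpace Y] [TopologicalSpace Z] {n : ℕ}

lemma subsingleton_iff : Subsingleton (Homology n X) ↔
    ∀ z : SingularChain n X, IsCycle z → ∃ w, boundary n X w = z := by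
  refine ⟨fun h z hz ↦ ?_, fun h ↦ subsingleton_of_forall_eq 0 fun x ↦ ?_⟩
  · obtain ⟨x, hx⟩ := hz.exists_represents
    exact hx.eq_zero_iff.1 (Subsingleton.elim _ _)
  · obtain ⟨z, hz⟩ := exists_represents x
    exact hz.eq_zero_iff.2 (h z hz.isCycle)

lemma map_injective_iff (f : C(X, Y)) : Function.Injective (Homology.map n f) ↔
    ∀ z : SingularChain n X, IsCycle z → (∃ w, boundary n Y w = push n f z) →
      ∃ w, boundary n X w = z := by
  rw [injective_iff_map_eq_zero]
  refine ⟨fun h z hz hw ↦ ?_, fun h x hx ↦ ?_⟩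
  · obtain ⟨x, hx⟩ := hz.exists_represents
    exact hx.eq_zero_iff.1 (h x ((hx.map f).eq_zero_iff.2 hw))
  · obtain ⟨z, hz⟩ := exists_represents x
    exact hz.eq_zero_iff.2 (h z hz.isCycle ((hz.map f).eq_zero_iff.1 hx))

lemma map_surjective_iff (f : C(X, Y)) : Function.Surjective (Homology.map n f) ↔
    ∀ z : SingularChain n Y, IsCycle z →
      ∃ z' : SingularChain n X, IsCycle z' ∧ ∃ w, z = push n f z' + boundary n Y w := by
  refine ⟨fun h z hz ↦ ?_, fun h y ↦ ?_⟩
  · obtain ⟨y, hy⟩ := hz.exists_represents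
    obtain ⟨x, rfl⟩ := h y
    obtain ⟨z', hz'⟩ := exists_represents x
    obtain ⟨w, hw⟩ := (hy.sub (hz'.map f)).eq_zero_iff.1 (sub_self _)
    exact ⟨z', hz'.isCycle, w, by rw [hw, add_sub_cancel]⟩
  · obtain ⟨z, hz⟩ := exists_represents y
    obtain ⟨z', hz', w, rfl⟩ := h z hz.isCycle
    obtain ⟨x, hx⟩ := hz'.exists_represents
    refine ⟨x, (sub_eq_zero.1 ((hz.sub (hx.map f)).eq_zero_iff.2 ⟨w, ?_⟩)).symm⟩
    rw [add_sub_cancel_left]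

lemma map_comp (g : C(Y, Z)) (f : C(X, Y)) :
    Homology.map n (g.comp f) = Homology.map n g ∘ₗ Homology.map n f :=
  congr(($((singularHomologyReal n).map_comp (TopCat.ofHom f) (TopCat.ofHom g))).hom)

lemma map_id : Homology.map n (ContinuousMap.id X) = LinearMap.id :=
  congr(($((singularHomologyReal n).map_id (TopCat.of X))).hom)

lemma map_eq_of_homotopic {f g : C(X, Y)} (h : f.Homotopic g) :
    Homology.map n f = Homology.map n g := by
  obtain ⟨H⟩ := h
  have H' : TopCat.Homotopy (TopCat.ofHom f) (TopCat.ofHom g) := by exact H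
  exact congr(($(H'.congr_homologyMap_singularChainComplexFunctor
    (ModuleCat.of ℝ (ULift.{u} ℝ)) n)).hom)

end Homology

end SingularComplex

/-! ### Formal affine chains: cones and subdivision. -/

/-- The module of formal real linear combinations of `m`-tuples of elements of `P`. For a convex
set `P` these are the affine chains of degree `m - 1`, augmented by the empty tuple. -/
abbrev TupleChain (P : Type*) (m : ℕ) : Type _ := (Fin m → P) →₀ ℝ

namespace TupleChain

variable {P Q : Type*} {m : ℕ}

open Finsupp

/-- The alternating sum of the faces of a tuple. -/
noncomputable def boundary (m : ℕ) : TupleChain P (m + 1) →ₗ[ℝ] TupleChain P m :=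
  linearCombination ℝ fun v ↦ ∑ i : Fin (m + 1), (-1 : ℝ) ^ (i : ℕ) • single (v ∘ i.succAbove) 1

/-- The cone with apex `p`, which puts `p` in front of a tuple. -/
noncomputable def cone (p : P) : TupleChain P m →ₗ[ℝ] TupleChain P (m + 1) :=
  linearCombination ℝ fun v ↦ single (Fin.cons p v : Fin (m + 1) → P) 1

/-- The map induced by a map of sets. -/
noncomputable def map (f : P → Q) : TupleChain P m →ₗ[ℝ] TupleChain Q m :=
  linearCombination ℝ fun v ↦ single (f ∘ v) 1

lemma boundary_single (v : Fin (m + 1) → P) : boundary m (single v 1) =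
    ∑ i : Fin (m + 1), (-1 : ℝ) ^ (i : ℕ) • single (v ∘ i.succAbove) 1 := by
  simp [boundary]

lemma cone_single (p : P) (v : Fin m → P) :
    cone p (single v 1) = single (Fin.cons p v : Fin (m + 1) → P) 1 := by
  simp [cone]

lemma map_single (f : P → Q) (v : Fin m → P) : map f (single v 1) = single (f ∘ v) 1 := by
  simp [map]

lemma hom_ext {N : Type*} [AddCommGroup N] [Module ℝ N] {φ ψ : TupleChain P m →ₗ[ℝ] N}
    (h : ∀ v, φ (single v 1) = ψ (single v 1)) : φ = ψ :=
  Finsupp.lhom_ext' fun v ↦ LinearMap.ext_ring (h v)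

lemma boundary_zero_cone (p : P) (c : TupleChain P 0) : boundary 0 (cone p c) = c := by
  suffices boundary 0 ∘ₗ cone p = LinearMap.id from congr($this c)
  refine hom_ext fun v ↦ ?_
  simp only [LinearMap.comp_apply, cone_single, boundary_single, LinearMap.id_apply]
  rw [Fin.sum_univ_one, Fin.val_zero, pow_zero, one_smul]
  exact congrArg (single · 1) (Subsingleton.elim _ _)

/-- The face omitting the apex returns the tuple; every other face is a cone on a face, with its
index shifted by one and hence its sign reversed. -/
lemma boundary_succ_cone (p : P) (c : TupleChain P (m + 1)) :
    boundary (m + 1) (cone p c) = c - cone p (boundary m c) := by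
  suffices boundary (m + 1) ∘ₗ cone p = LinearMap.id - cone p ∘ₗ boundary m from congr($this c)
  refine hom_ext fun v ↦ ?_
  simp only [LinearMap.comp_apply, cone_single, boundary_single, LinearMap.id_apply,
    LinearMap.sub_apply, map_sum, map_smul]
  rw [Fin.sum_univ_succ, sub_eq_add_neg, ← Finset.sum_neg_distrib]
  congr 1
  · rw [Fin.val_zero, pow_zero, one_smul]
    exact congrArg (single · 1) (funext fun i ↦ by simp)
  · refine Finset.sum_congr rfl fun i _ ↦ ?_
    rw [Fin.val_succ, pow_succ, mul_neg_one, neg_smul]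
    congr 3
    funext k
    refine Fin.cases ?_ (fun k ↦ ?_) k <;> simp

lemma single_eq_cone (v : Fin (m + 1) → P) :
    single v (1 : ℝ) = cone (v 0) (single (Fin.tail v) 1) := by
  rw [cone_single, Fin.cons_self_tail]

/-- Every nonempty tuple is the cone on its tail, so the cone formula and induction replace the
usual double sum. -/
lemma boundary_boundary (c : TupleChain P (m + 2)) : boundary m (boundary (m + 1) c) = 0 := by
  suffices boundary m ∘ₗ boundary (m + 1) = (0 : TupleChain P (m + 2) →ₗ[ℝ] _) from congr($this c)
  induction m with
  | zero =>
    refine hom_ext fun v ↦ ?_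
    rw [single_eq_cone, LinearMap.comp_apply, boundary_succ_cone, map_sub, boundary_zero_cone,
      sub_self, LinearMap.zero_apply]
  | succ m ih =>
    refine hom_ext fun v ↦ ?_
    have h := congr($(ih 0) (single (Fin.tail v) 1))
    rw [LinearMap.comp_apply, LinearMap.zero_apply] at h
    rw [single_eq_cone, LinearMap.comp_apply, boundary_succ_cone, map_sub, boundary_succ_cone, h,
      map_zero, sub_zero, sub_self, LinearMap.zero_apply]

lemma map_boundary (f : P → Q) (c : TupleChain P (m + 1)) :
    map f (boundary m c) = boundary m (map f c) := by
  suffices map f ∘ₗ boundary m = boundary m ∘ₗ map f from congr($this c)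
  refine hom_ext fun v ↦ ?_
  simp only [LinearMap.comp_apply, map_single, boundary_single, map_sum, map_smul]
  rfl

lemma map_cone (f : P → Q) (p : P) (c : TupleChain P m) :
    map f (cone p c) = cone (f p) (map f c) := by
  suffices map f ∘ₗ cone p = cone (f p) ∘ₗ map f from congr($this c)
  refine hom_ext fun v ↦ ?_
  simp only [LinearMap.comp_apply, map_single, cone_single]
  exact congrArg (single · 1) (funext fun i ↦ by refine Fin.cases ?_ (fun k ↦ ?_) i <;> simp)

section Subdivision

variable (b : ∀ m, (Fin (m + 1) → P) → P) (b' : ∀ m, (Fin (m + 1) → Q) → Q)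

/-- The subdivision operator given by a choice of a centre for each tuple. -/
noncomputable def subdivide : ∀ m, TupleChain P m →ₗ[ℝ] TupleChain P m
  | 0 => LinearMap.id
  | m + 1 => linearCombination ℝ fun v ↦ cone (b m v) (subdivide m (boundary m (single v 1)))

/-- The chain homotopy from the subdivision operator to the identity. -/
noncomputable def subdivideHomotopy : ∀ m, TupleChain P m →ₗ[ℝ] TupleChain P (m + 1)
  | 0 => 0
  | m + 1 => linearCombination ℝ fun v ↦
      cone (b m v) (single v 1 - subdivideHomotopy m (boundary m (single v 1)))

lemma subdivide_succ_single (v : Fin (m + 1) → P) : subdivide b (m + 1) (single v 1) =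
    cone (b m v) (subdivide b m (boundary m (single v 1))) := by
  simp [subdivide]

lemma subdivideHomotopy_succ_single (v : Fin (m + 1) → P) :
    subdivideHomotopy b (m + 1) (single v 1) =
      cone (b m v) (single v 1 - subdivideHomotopy b m (boundary m (single v 1))) := by
  simp [subdivideHomotopy]

/-- Write S for subdivision. By the cone formula, ∂(b·S∂v) = S∂v − b·∂S∂v, and ∂S∂v = S∂∂v = 0 by
induction. -/
lemma boundary_subdivide (c : TupleChain P (m + 1)) :
    boundary m (subdivide b (m + 1) c) = subdivide b m (boundary m c) := by
  induction m with
  | zero =>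
    suffices boundary 0 ∘ₗ subdivide b 1 = subdivide b 0 ∘ₗ boundary 0 from congr($this c)
    refine hom_ext fun v ↦ ?_
    rw [LinearMap.comp_apply, LinearMap.comp_apply, subdivide_succ_single, boundary_zero_cone]
  | succ m ih =>
    suffices boundary (m + 1) ∘ₗ subdivide b (m + 2) = subdivide b (m + 1) ∘ₗ boundary (m + 1)
      from congr($this c)
    refine hom_ext fun v ↦ ?_
    rw [LinearMap.comp_apply, LinearMap.comp_apply, subdivide_succ_single, boundary_succ_cone, ih,
      boundary_boundary, map_zero, map_zero, sub_zero]

lemma boundary_subdivideHomotopy (c : TupleChain P (m + 1)) :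
    boundary (m + 1) (subdivideHomotopy b (m + 1) c) + subdivideHomotopy b m (boundary m c) =
      c - subdivide b (m + 1) c := by
  -- With S the subdivision and T the homotopy, the cone formula reduces the identity to ∂(v − T∂v)
  -- = S∂v. This in turn is the identity one degree lower, applied to ∂v.
  have step : ∀ m : ℕ, (∀ v : Fin (m + 1) → P,
      boundary m (single v 1 - subdivideHomotopy b m (boundary m (single v 1))) =
        subdivide b m (boundary m (single v 1))) → ∀ c : TupleChain P (m + 1),
      boundary (m + 1) (subdivideHomotopy b (m + 1) c) + subdivideHomotopy b m (boundary m c) =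
        c - subdivide b (m + 1) c := fun m key c ↦ by
    suffices boundary (m + 1) ∘ₗ subdivideHomotopy b (m + 1) +
      subdivideHomotopy b m ∘ₗ boundary m = LinearMap.id - subdivide b (m + 1) from congr($this c)
    refine hom_ext fun v ↦ ?_
    simp only [LinearMap.add_apply, LinearMap.comp_apply, LinearMap.sub_apply, LinearMap.id_apply]
    rw [subdivideHomotopy_succ_single, boundary_succ_cone, key, subdivide_succ_single]
    abel
  refine step m ?_ c
  clear c
  induction m with
  | zero => simp [subdivideHomotopy, subdivide]
  | succ m ih =>
    intro v
    have := step m ih (boundary (m + 1) (single v 1))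
    rw [boundary_boundary, map_zero, add_zero] at this
    rw [map_sub, this, sub_sub_cancel]

variable {b b'}

/-- The application is to affine maps between simplices, which preserve barycentres. -/
lemma map_subdivide {f : P → Q} (hf : ∀ m v, f (b m v) = b' m (f ∘ v)) :
    ∀ {m : ℕ} (c : TupleChain P m), map f (subdivide b m c) = subdivide b' m (map f c)
  | 0, _ => rfl
  | m + 1, c => by
    suffices map f ∘ₗ subdivide b (m + 1) = subdivide b' (m + 1) ∘ₗ map f from congr($this c)
    refine hom_ext fun v ↦ ?_
    rw [LinearMap.comp_apply, LinearMap.comp_apply, subdivide_succ_single, map_cone,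
      map_subdivide hf, map_boundary, map_single, subdivide_succ_single, hf]

lemma map_subdivideHomotopy {f : P → Q} (hf : ∀ m v, f (b m v) = b' m (f ∘ v)) :
    ∀ {m : ℕ} (c : TupleChain P m),
      map f (subdivideHomotopy b m c) = subdivideHomotopy b' m (map f c)
  | 0, _ => by simp [subdivideHomotopy]
  | m + 1, c => by
    suffices map f ∘ₗ subdivideHomotopy b (m + 1) = subdivideHomotopy b' (m + 1) ∘ₗ map f
      from congr($this c)
    refine hom_ext fun v ↦ ?_
    rw [LinearMap.comp_apply, LinearMap.comp_apply, subdivideHomotopy_succ_single, map_cone,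
      map_sub, map_subdivideHomotopy hf, map_boundary, map_single, subdivideHomotopy_succ_single,
      hf]

end Subdivision

lemma apply_mem_of_mem_supported {N : Type*} [AddCommGroup N] [Module ℝ N]
    (φ : TupleChain P m →ₗ[ℝ] N) {s : Set (Fin m → P)} {W : Submodule ℝ N}
    (h : ∀ v ∈ s, φ (single v 1) ∈ W) {c : TupleChain P m} (hc : c ∈ supported ℝ ℝ s) :
    φ c ∈ W := by
  rw [supported_eq_span_single] at hc
  have : Submodule.span ℝ ((fun i ↦ single i (1 : ℝ)) '' s) ≤ W.comap φ :=
    Submodule.span_le.2 (by rintro _ ⟨v, hv, rfl⟩; exact h v hv)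
  exact this hc

lemma boundary_mem_supported {s : Set (Fin (m + 1) → P)} {t : Set (Fin m → P)}
    (h : ∀ v ∈ s, ∀ i : Fin (m + 1), v ∘ i.succAbove ∈ t) {c : TupleChain P (m + 1)}
    (hc : c ∈ supported ℝ ℝ s) : boundary m c ∈ supported ℝ ℝ t :=
  apply_mem_of_mem_supported _ (fun v hv ↦ by
    rw [boundary_single]
    exact Submodule.sum_mem _ fun i _ ↦
      Submodule.smul_mem _ _ (single_mem_supported ℝ 1 (h v hv i))) hc

lemma cone_mem_supported {p : P} {s : Set (Fin m → P)} {t : Set (Fin (m + 1) → P)}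
    (h : ∀ v ∈ s, (Fin.cons p v : Fin (m + 1) → P) ∈ t) {c : TupleChain P m}
    (hc : c ∈ supported ℝ ℝ s) : cone p c ∈ supported ℝ ℝ t :=
  apply_mem_of_mem_supported _ (fun v hv ↦ by
    rw [cone_single]
    exact single_mem_supported ℝ 1 (h v hv)) hc

lemma subdivide_mem_supported_of_forall_mem {b : ∀ m, (Fin (m + 1) → P) → P} {K : Set P}
    (hK : ∀ m (v : Fin (m + 1) → P), (∀ i, v i ∈ K) → b m v ∈ K) :
    ∀ {m : ℕ} {c : TupleChain P m}, c ∈ supported ℝ ℝ {v : Fin m → P | ∀ i, v i ∈ K} →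
      subdivide b m c ∈ supported ℝ ℝ {v : Fin m → P | ∀ i, v i ∈ K}
  | 0, _, hc => hc
  | m + 1, _, hc => apply_mem_of_mem_supported _ (fun v hv ↦ by
      rw [subdivide_succ_single]
      refine cone_mem_supported (s := {v : Fin m → P | ∀ i, v i ∈ K})
        (t := {v : Fin (m + 1) → P | ∀ i, v i ∈ K}) ?_
        (subdivide_mem_supported_of_forall_mem hK (boundary_mem_supported
          (s := {v : Fin (m + 1) → P | ∀ i, v i ∈ K}) (t := {v : Fin m → P | ∀ i, v i ∈ K})
          (fun v hv i j ↦ hv _)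
          (single_mem_supported ℝ 1 hv)))
      exact fun w hw i ↦ Fin.cases (hK m v hv) (fun k ↦ hw k) i) hc

end TupleChain

/-! ### Affine simplices, barycentres and mesh estimates. -/

namespace stdSimplex

variable {ι κ τ : Type*} [Fintype ι] [Fintype κ] [Fintype τ]

/-- The affine map between standard simplices with prescribed values on the vertices. -/
noncomputable def affine (v : ι → stdSimplex ℝ κ) : C(stdSimplex ℝ ι, stdSimplex ℝ κ) where
  toFun x := ⟨∑ i, x i • (v i : κ → ℝ),
    (convex_stdSimplex ℝ κ).sum_mem (fun i _ ↦ x.2.1 i) x.2.2 fun i _ ↦ (v i).2⟩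
  continuous_toFun := by
    refine Continuous.subtype_mk (continuous_finsetSum _ fun i _ ↦ ?_) _
    exact ((continuous_apply i).comp continuous_subtype_val).smul continuous_const

lemma affine_coe (v : ι → stdSimplex ℝ κ) (x : stdSimplex ℝ ι) :
    (affine v x : κ → ℝ) = ∑ i, x i • (v i : κ → ℝ) := rfl

lemma affine_affine (v : ι → stdSimplex ℝ κ) (w : τ → stdSimplex ℝ ι) (x : stdSimplex ℝ τ) :
    affine v (affine w x) = affine (affine v ∘ w) x := by
  ext j
  change (∑ i, (∑ k, x k • (w k : ι → ℝ)) i • (v i : κ → ℝ)) j =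
    (∑ k, x k • ∑ i, w k i • (v i : κ → ℝ)) j
  simp only [Finset.sum_apply, Pi.smul_apply, smul_eq_mul, Finset.sum_mul, Finset.mul_sum]
  rw [Finset.sum_comm]
  exact Finset.sum_congr rfl fun k _ ↦ Finset.sum_congr rfl fun i _ ↦ mul_assoc _ _ _

lemma affine_comp (v : ι → stdSimplex ℝ κ) (w : τ → stdSimplex ℝ ι) :
    (affine v).comp (affine w) = affine (affine v ∘ w) :=
  ContinuousMap.ext (affine_affine v w)

lemma affine_map (v : ι → stdSimplex ℝ κ) (f : τ → ι) (x : stdSimplex ℝ τ) :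
    affine v (map f x) = affine (v ∘ f) x := by
  classical
  ext j
  change (∑ i, (FunOnFinite.linearMap ℝ ℝ f x) i • (v i : κ → ℝ)) j =
    (∑ k, x k • (v (f k) : κ → ℝ)) j
  simp only [Finset.sum_apply, Pi.smul_apply, smul_eq_mul, FunOnFinite.linearMap_apply_apply,
    Finset.sum_mul]
  rw [← Finset.sum_fiberwise Finset.univ f]
  refine Finset.sum_congr rfl fun i _ ↦ Finset.sum_congr rfl fun k hk ↦ ?_
  rw [(Finset.mem_filter.1 hk).2]

lemma affine_vertex [DecidableEq ι] (v : ι → stdSimplex ℝ κ) (i : ι) :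
    affine v (vertex i) = v i := by
  ext j
  change (∑ k, (Pi.single i 1 : ι → ℝ) k • (v k : κ → ℝ)) j = v i j
  rw [Finset.sum_eq_single i (fun k _ hk ↦ by simp [hk]) (by simp)]
  simp

lemma affine_vertices [DecidableEq ι] :
    affine (vertex : ι → stdSimplex ℝ ι) = ContinuousMap.id _ := by
  ext x j
  change (∑ k, x k • (Pi.single k 1 : ι → ℝ)) j = x j
  simp [Finset.sum_apply, Pi.single_apply]

lemma affine_mem {v : ι → stdSimplex ℝ κ} {K : Set (κ → ℝ)} (hK : Convex ℝ K)
    (hv : ∀ i, (v i : κ → ℝ) ∈ K) (x : stdSimplex ℝ ι) : (affine v x : κ → ℝ) ∈ K :=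
  hK.sum_mem (fun i _ ↦ x.2.1 i) x.2.2 fun i _ ↦ hv i

/-- The barycentre of a tuple of points of a standard simplex. -/
noncomputable def centre (m : ℕ) (v : Fin (m + 1) → stdSimplex ℝ κ) : stdSimplex ℝ κ :=
  affine v barycenter

lemma affine_centre (w : ι → stdSimplex ℝ κ) (m : ℕ) (v : Fin (m + 1) → stdSimplex ℝ ι) :
    affine w (centre m v) = centre m (affine w ∘ v) := affine_affine _ _ _

/-- The vector from the centre to `v i` is the average of the `m + 1` differences `v i - v j`, one
of which is zero. -/
lemma dist_centre_le {m : ℕ} {v : Fin (m + 1) → stdSimplex ℝ κ} {r : ℝ}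
    (hv : ∀ i j, dist (v i) (v j) ≤ r) (i : Fin (m + 1)) :
    dist (v i) (centre m v) ≤ m / (m + 1) * r := by
  have e : (v i : κ → ℝ) - (centre m v : κ → ℝ) =
      ∑ j, (m + 1 : ℝ)⁻¹ • ((v i : κ → ℝ) - (v j : κ → ℝ)) := by
    have h1 : (centre m v : κ → ℝ) = ∑ j, (m + 1 : ℝ)⁻¹ • (v j : κ → ℝ) := by
      rw [centre, affine_coe]
      refine Finset.sum_congr rfl fun j _ ↦ congrArg (· • (v j : κ → ℝ)) ?_
      change (Fintype.card (Fin (m + 1)) : ℝ)⁻¹ = _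
      simp
    simp_rw [h1, smul_sub, Finset.sum_sub_distrib, ← Finset.smul_sum]
    rw [Finset.sum_const, Finset.card_univ, Fintype.card_fin, ← Nat.cast_smul_eq_nsmul ℝ, smul_smul,
      Nat.cast_succ, inv_mul_cancel₀ (by positivity), one_smul]
  change dist (v i : κ → ℝ) (centre m v : κ → ℝ) ≤ _
  rw [dist_eq_norm, e, ← Finset.sum_erase Finset.univ (a := i) (by simp)]
  calc _ ≤ ∑ j ∈ Finset.univ.erase i, (m + 1 : ℝ)⁻¹ * r := by
        refine norm_sum_le_of_le _ fun j _ ↦ ?_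
        rw [norm_smul, Real.norm_of_nonneg (by positivity), ← dist_eq_norm]
        exact mul_le_mul_of_nonneg_left (hv i j) (by positivity)
    _ = m / (m + 1) * r := by
        rw [Finset.sum_const, Finset.card_erase_of_mem (Finset.mem_univ i), Finset.card_univ,
          Fintype.card_fin, nsmul_eq_mul, Nat.add_sub_cancel]
        ring

end stdSimplex

namespace TupleChain

open Finsupp stdSimplex

variable {κ : Type*} [Fintype κ]

/-- The tuples of points of a standard simplex with mutual distances at most `r`. -/
def fineTuples (κ : Type*) [Fintype κ] (m : ℕ) (r : ℝ) : Set (Fin m → stdSimplex ℝ κ) :=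
  {v | ∀ i j, dist (v i) (v j) ≤ r}

/-- One contraction factor serves all tuples of length at most `M + 1`, which lets the induction
pass to faces. The subdivided faces are fine by induction, and by convexity they stay in the ball
about the centre, so prepending the centre keeps them fine. -/
lemma subdivide_mem_fineTuples {M : ℕ} {r : ℝ} (hr : 0 ≤ r) : ∀ {m : ℕ}, m ≤ M + 1 →
    ∀ {c : TupleChain (stdSimplex ℝ κ) m}, c ∈ supported ℝ ℝ (fineTuples κ m r) →
      subdivide centre m c ∈ supported ℝ ℝ (fineTuples κ m (M / (M + 1) * r))
  | 0, _, c, hc => by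
    rw [mem_supported] at hc ⊢
    exact fun v _ i ↦ i.elim0
  | m + 1, hm, c, hc => apply_mem_of_mem_supported _ (fun v hv ↦ by
      set ρ : ℝ := M / (M + 1) * r
      have hρ : 0 ≤ ρ := by positivity
      have hle : (m : ℝ) / (m + 1) * r ≤ ρ := by
        refine mul_le_mul_of_nonneg_right ?_ hr
        have : (m : ℝ) ≤ M := by exact_mod_cast Nat.le_of_succ_le_succ hm
        rw [div_le_div_iff₀ (by positivity) (by positivity)]
        nlinarith
      let K : Set (stdSimplex ℝ κ) := {p | (p : κ → ℝ) ∈ Metric.closedBall (centre m v : κ → ℝ) ρ}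
      have hK : ∀ i, v i ∈ K := fun i ↦ (dist_centre_le hv i).trans hle
      have h1 := boundary_mem_supported (s := fineTuples κ (m + 1) r)
        (t := fineTuples κ m r) (fun w hw i j k ↦ hw _ _)
        (single_mem_supported ℝ 1 hv)
      have h2 := boundary_mem_supported (s := {w : Fin (m + 1) → stdSimplex ℝ κ | ∀ i, w i ∈ K})
        (t := {w : Fin m → stdSimplex ℝ κ | ∀ i, w i ∈ K}) (fun w hw i j ↦ hw _)
        (single_mem_supported ℝ 1 hK)
      have h3 := subdivide_mem_fineTuples hr (Nat.le_of_succ_le hm) h1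
      have h4 := subdivide_mem_supported_of_forall_mem (b := centre) (K := K)
        (fun _ w hw ↦ affine_mem (v := w)
          (convex_closedBall (centre m v : κ → ℝ) ρ) hw _) h2
      rw [subdivide_succ_single]
      refine cone_mem_supported (s := fineTuples κ m ρ ∩ {w | ∀ i, w i ∈ K}) ?_
        (by rw [supported_inter]; exact ⟨h3, h4⟩)
      rintro w ⟨hw, hwK⟩ i j
      have hwK' : ∀ i, dist (w i) (centre m v) ≤ ρ := hwK
      refine Fin.cases ?_ (fun i ↦ ?_) i <;> refine Fin.cases ?_ (fun j ↦ ?_) j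
      · simpa using hρ
      · simpa [dist_comm] using hwK' j
      · simpa using hwK' i
      · simpa using hw i j) hc

lemma iterate_subdivide_mem_fineTuples {M : ℕ} {r : ℝ} (hr : 0 ≤ r)
    {c : TupleChain (stdSimplex ℝ κ) (M + 1)} (hc : c ∈ supported ℝ ℝ (fineTuples κ (M + 1) r))
    (N : ℕ) : (subdivide centre (M + 1))^[N] c ∈
      supported ℝ ℝ (fineTuples κ (M + 1) ((M / (M + 1) : ℝ) ^ N * r)) := by
  induction N with
  | zero => simpa using hc
  | succ N ih =>
    rw [Function.iterate_succ_apply', pow_succ', mul_assoc]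
    exact subdivide_mem_fineTuples (by positivity) le_rfl ih

end TupleChain

/-! ### Subdivision of singular chains and the small chains theorem. -/

namespace SingularChain

open stdSimplex

variable {X Y : Type u} [TopologicalSpace X] [TopologicalSpace Y] {m n : ℕ}

/-- The singular chain of a formal affine chain in the domain of a singular simplex. -/
noncomputable def ofTuples (σ : C(TopSimplex n, X)) (m : ℕ) :
    TupleChain (TopSimplex n) (m + 1) →ₗ[ℝ] SingularChain m X :=
  Finsupp.linearCombination ℝ fun v ↦ basis m X (σ.comp (affine v))

lemma ofTuples_single (σ : C(TopSimplex n, X)) (v : Fin (m + 1) → TopSimplex n) :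
    ofTuples σ m (Finsupp.single v 1) = basis m X (σ.comp (affine v)) := by
  simp [ofTuples]

lemma ofTuples_vertices (σ : C(TopSimplex n, X)) :
    ofTuples σ n (Finsupp.single vertex 1) = basis n X σ := by
  rw [ofTuples_single, affine_vertices, ContinuousMap.comp_id]

lemma boundary_ofTuples (σ : C(TopSimplex n, X)) (c : TupleChain (TopSimplex n) (m + 2)) :
    boundary m X (ofTuples σ (m + 1) c) = ofTuples σ m (TupleChain.boundary (m + 1) c) := by
  suffices boundary m X ∘ₗ ofTuples σ (m + 1) = ofTuples σ m ∘ₗ TupleChain.boundary (m + 1)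
    from congr($this c)
  refine TupleChain.hom_ext fun v ↦ ?_
  simp only [LinearMap.comp_apply, ofTuples_single, boundary_basis, TupleChain.boundary_single,
    map_sum, map_smul]
  refine Finset.sum_congr rfl fun i _ ↦ ?_
  congr 2
  exact ContinuousMap.ext fun x ↦ congrArg σ (affine_map v i.succAbove x)

lemma ofTuples_comp_affine (σ : C(TopSimplex n, X)) {k : ℕ} (v : Fin (k + 1) → TopSimplex n)
    (c : TupleChain (TopSimplex k) (m + 1)) :
    ofTuples (σ.comp (affine v)) m c = ofTuples σ m (TupleChain.map (affine v) c) := by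
  suffices ofTuples (σ.comp (affine v)) m = ofTuples σ m ∘ₗ TupleChain.map (affine v)
    from congr($this c)
  refine TupleChain.hom_ext fun w ↦ ?_
  rw [LinearMap.comp_apply, TupleChain.map_single, ofTuples_single, ofTuples_single,
    ContinuousMap.comp_assoc, affine_comp]

/-- Barycentric subdivision of singular chains. -/
noncomputable def subdivide (n : ℕ) (X : Type u) [TopologicalSpace X] :
    SingularChain n X →ₗ[ℝ] SingularChain n X :=
  (basis n X).constr ℝ fun σ ↦
    ofTuples σ n (TupleChain.subdivide centre (n + 1) (Finsupp.single vertex 1))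

/-- The chain homotopy from barycentric subdivision to the identity. -/
noncomputable def subdivideHomotopy (n : ℕ) (X : Type u) [TopologicalSpace X] :
    SingularChain n X →ₗ[ℝ] SingularChain (n + 1) X :=
  (basis n X).constr ℝ fun σ ↦
    ofTuples σ (n + 1) (TupleChain.subdivideHomotopy centre (n + 1) (Finsupp.single vertex 1))

lemma map_affine_vertices (v : Fin (m + 1) → TopSimplex n) :
    TupleChain.map (affine v) (Finsupp.single vertex 1) = Finsupp.single v 1 := by
  rw [TupleChain.map_single]
  congr 1
  exact funext fun i ↦ affine_vertex v i

/-- Subdivision is defined on the universal simplex; the agreement on all affine simplices holds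
because affine maps preserve centres. Identities for tuples then transfer to singular chains. -/
lemma subdivide_ofTuples (σ : C(TopSimplex n, X)) (c : TupleChain (TopSimplex n) (m + 1)) :
    subdivide m X (ofTuples σ m c) = ofTuples σ m (TupleChain.subdivide centre (m + 1) c) := by
  suffices subdivide m X ∘ₗ ofTuples σ m = ofTuples σ m ∘ₗ TupleChain.subdivide centre (m + 1)
    from congr($this c)
  refine TupleChain.hom_ext fun v ↦ ?_
  rw [LinearMap.comp_apply, LinearMap.comp_apply, ofTuples_single, subdivide,
    Module.Basis.constr_basis, ofTuples_comp_affine, TupleChain.map_subdivide (affine_centre v),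
    map_affine_vertices]

lemma subdivideHomotopy_ofTuples (σ : C(TopSimplex n, X))
    (c : TupleChain (TopSimplex n) (m + 1)) : subdivideHomotopy m X (ofTuples σ m c) =
      ofTuples σ (m + 1) (TupleChain.subdivideHomotopy centre (m + 1) c) := by
  suffices subdivideHomotopy m X ∘ₗ ofTuples σ m =
    ofTuples σ (m + 1) ∘ₗ TupleChain.subdivideHomotopy centre (m + 1) from congr($this c)
  refine TupleChain.hom_ext fun v ↦ ?_
  rw [LinearMap.comp_apply, LinearMap.comp_apply, ofTuples_single, subdivideHomotopy,
    Module.Basis.constr_basis, ofTuples_comp_affine,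
    TupleChain.map_subdivideHomotopy (affine_centre v), map_affine_vertices]

lemma boundary_subdivide (c : SingularChain (n + 1) X) :
    boundary n X (subdivide (n + 1) X c) = subdivide n X (boundary n X c) := by
  suffices boundary n X ∘ₗ subdivide (n + 1) X = subdivide n X ∘ₗ boundary n X from congr($this c)
  refine (basis (n + 1) X).ext fun σ ↦ ?_
  rw [LinearMap.comp_apply, LinearMap.comp_apply, ← ofTuples_vertices, subdivide_ofTuples,
    boundary_ofTuples, TupleChain.boundary_subdivide, boundary_ofTuples, subdivide_ofTuples]

lemma boundary_subdivideHomotopy (c : SingularChain (n + 1) X) :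
    boundary (n + 1) X (subdivideHomotopy (n + 1) X c) + subdivideHomotopy n X (boundary n X c) =
      c - subdivide (n + 1) X c := by
  suffices boundary (n + 1) X ∘ₗ subdivideHomotopy (n + 1) X +
    subdivideHomotopy n X ∘ₗ boundary n X = LinearMap.id - subdivide (n + 1) X from congr($this c)
  refine (basis (n + 1) X).ext fun σ ↦ ?_
  simp only [LinearMap.add_apply, LinearMap.comp_apply, LinearMap.sub_apply, LinearMap.id_apply]
  rw [← ofTuples_vertices, subdivideHomotopy_ofTuples, boundary_ofTuples, boundary_ofTuples,
    subdivideHomotopy_ofTuples, ← map_add, TupleChain.boundary_subdivideHomotopy, map_sub,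
    subdivide_ofTuples]

/-- The singular chains supported in a subset. -/
noncomputable def within (n : ℕ) (V : Set X) : Submodule ℝ (SingularChain n X) :=
  Submodule.span ℝ (basis n X '' {σ | Set.range σ ⊆ V})

lemma basis_mem_within {V : Set X} {σ : C(TopSimplex n, X)} (h : ∀ x, σ x ∈ V) :
    basis n X σ ∈ within n V :=
  Submodule.subset_span ⟨σ, Set.range_subset_iff.2 h, rfl⟩

lemma apply_mem_of_mem_within {N : Type*} [AddCommGroup N] [Module ℝ N]
    (φ : SingularChain n X →ₗ[ℝ] N) {V : Set X} {W : Submodule ℝ N}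
    (h : ∀ σ : C(TopSimplex n, X), (∀ x, σ x ∈ V) → φ (basis n X σ) ∈ W)
    {c : SingularChain n X} (hc : c ∈ within n V) : φ c ∈ W := by
  have : within n V ≤ W.comap φ := Submodule.span_le.2 <| by
    rintro _ ⟨σ, hσ, rfl⟩
    exact h σ (Set.range_subset_iff.1 hσ)
  exact this hc

lemma ofTuples_mem_within {V : Set X} {σ : C(TopSimplex n, X)} (hσ : ∀ x, σ x ∈ V)
    (c : TupleChain (TopSimplex n) (m + 1)) : ofTuples σ m c ∈ within m V := by
  refine TupleChain.apply_mem_of_mem_supported (s := Set.univ) _ (fun v _ ↦ ?_)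
    (by rw [Finsupp.supported_univ]; trivial)
  rw [ofTuples_single]
  exact basis_mem_within fun x ↦ hσ _

lemma subdivide_mem_within {V : Set X} {c : SingularChain n X} (hc : c ∈ within n V) :
    subdivide n X c ∈ within n V :=
  apply_mem_of_mem_within _ (fun σ hσ ↦ by
    rw [subdivide, Module.Basis.constr_basis]
    exact ofTuples_mem_within hσ _) hc

lemma subdivideHomotopy_mem_within {V : Set X} {c : SingularChain n X} (hc : c ∈ within n V) :
    subdivideHomotopy n X c ∈ within (n + 1) V :=
  apply_mem_of_mem_within _ (fun σ hσ ↦ by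
    rw [subdivideHomotopy, Module.Basis.constr_basis]
    exact ofTuples_mem_within hσ _) hc

lemma boundary_mem_within {V : Set X} {c : SingularChain (n + 1) X} (hc : c ∈ within (n + 1) V) :
    boundary n X c ∈ within n V :=
  apply_mem_of_mem_within _ (fun σ hσ ↦ by
    rw [← ofTuples_vertices, boundary_ofTuples]
    exact ofTuples_mem_within hσ _) hc

lemma iterate_subdivide_ofTuples (σ : C(TopSimplex n, X)) (c : TupleChain (TopSimplex n) (m + 1))
    (N : ℕ) : (subdivide m X)^[N] (ofTuples σ m c) =
      ofTuples σ m ((TupleChain.subdivide centre (m + 1))^[N] c) := by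
  induction N with
  | zero => rfl
  | succ N ih => rw [Function.iterate_succ_apply', ih, subdivide_ofTuples,
      Function.iterate_succ_apply']

/-- Once the mesh is below a Lebesgue number of the pulled-back cover, each affine piece lies in a
ball about its first vertex that maps into `U` or `V`. -/
lemma exists_iterate_subdivide_basis_mem {U V : Set X} (hU : IsOpen U) (hV : IsOpen V)
    (hUV : U ∪ V = Set.univ) (σ : C(TopSimplex n, X)) :
    ∃ N, (subdivide n X)^[N] (basis n X σ) ∈ within n U ⊔ within n V := by
  obtain ⟨δ, hδ, h⟩ := lebesgue_number_lemma_of_metric (s := (Set.univ : Set (TopSimplex n)))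
    (c := fun b : Bool ↦ σ ⁻¹' (if b then U else V)) isCompact_univ
    (fun b ↦ by cases b <;> simp [hU.preimage σ.continuous, hV.preimage σ.continuous])
    (fun x _ ↦ by
      rcases (hUV.ge (Set.mem_univ (σ x)) : σ x ∈ U ∪ V) with hx | hx
      · exact Set.mem_iUnion.2 ⟨true, hx⟩
      · exact Set.mem_iUnion.2 ⟨false, hx⟩)
  have hc : ((n : ℝ) / (n + 1)) < 1 := by
    rw [div_lt_one (by positivity)]
    linarith
  obtain ⟨N, hN⟩ := exists_pow_lt_of_lt_one hδ hc
  refine ⟨N, ?_⟩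
  rw [← ofTuples_vertices, iterate_subdivide_ofTuples]
  -- The standard simplex has diameter at most `1`, so the mesh after `N` subdivisions is at most
  -- `(n / (n + 1)) ^ N`.
  have hv : Finsupp.single (vertex : Fin (n + 1) → TopSimplex n) (1 : ℝ) ∈
      Finsupp.supported ℝ ℝ (TupleChain.fineTuples (Fin (n + 1)) (n + 1) 1) := by
    refine Finsupp.single_mem_supported ℝ 1 fun i j ↦ ?_
    exact (Metric.dist_le_diam_of_mem (bounded_stdSimplex _) (vertex i).2 (vertex j).2).trans
      diam_stdSimplex_le
  refine TupleChain.apply_mem_of_mem_supported _ (fun v hv ↦ ?_)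
    (TupleChain.iterate_subdivide_mem_fineTuples zero_le_one hv N)
  rw [ofTuples_single]
  obtain ⟨b, hb⟩ := h (v 0) (Set.mem_univ _)
  have hx : ∀ x, affine v x ∈ Metric.ball (v 0) δ := fun x ↦
    affine_mem (v := v) (K := Metric.ball ((v 0 : TopSimplex n) : Fin (n + 1) → ℝ) δ)
      (convex_ball _ _) (fun i ↦ (hv i 0).trans_lt (by simpa using hN)) x
  cases b
  · exact Submodule.mem_sup_right (basis_mem_within fun x ↦ hb (hx x))
  · exact Submodule.mem_sup_left (basis_mem_within fun x ↦ hb (hx x))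

lemma subdivide_mem_sup {U V : Set X} {c : SingularChain n X} (hc : c ∈ within n U ⊔ within n V) :
    subdivide n X c ∈ within n U ⊔ within n V := by
  obtain ⟨a, ha, b, hb, rfl⟩ := Submodule.mem_sup.1 hc
  rw [map_add]
  exact Submodule.add_mem_sup (subdivide_mem_within ha) (subdivide_mem_within hb)

lemma iterate_subdivide_mem_sup {U V : Set X} {c : SingularChain n X}
    (hc : c ∈ within n U ⊔ within n V) (N : ℕ) :
    (subdivide n X)^[N] c ∈ within n U ⊔ within n V := by
  induction N with
  | zero => exact hc
  | succ N ih =>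
    rw [Function.iterate_succ_apply']
    exact subdivide_mem_sup ih

/-- Different simplices need different numbers of subdivisions, but small chains stay small, so the
exponents of two summands may be added. -/
lemma exists_iterate_subdivide_mem {U V : Set X} (hU : IsOpen U) (hV : IsOpen V)
    (hUV : U ∪ V = Set.univ) (c : SingularChain n X) :
    ∃ N, (subdivide n X)^[N] c ∈ within n U ⊔ within n V := by
  have hc : c ∈ Submodule.span ℝ (Set.range (basis n X)) := by
    rw [(basis n X).span_eq]
    trivial
  induction hc using Submodule.span_induction with
  | mem x hx =>
    obtain ⟨σ, rfl⟩ := hx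
    exact exists_iterate_subdivide_basis_mem hU hV hUV σ
  | zero => exact ⟨0, Submodule.zero_mem _⟩
  | add x y _ _ hx hy =>
    obtain ⟨N, hN⟩ := hx
    obtain ⟨M, hM⟩ := hy
    refine ⟨N + M, ?_⟩
    rw [iterate_map_add]
    refine Submodule.add_mem _ ?_ ?_
    · rw [add_comm, Function.iterate_add_apply]
      exact iterate_subdivide_mem_sup hN M
    · rw [Function.iterate_add_apply]
      exact iterate_subdivide_mem_sup hM N
  | smul a x _ hx =>
    obtain ⟨N, hN⟩ := hx
    refine ⟨N, ?_⟩
    have : (subdivide n X)^[N] (a • x) = a • (subdivide n X)^[N] x := by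
      rw [← Module.End.coe_pow, map_smul]
    rw [this]
    exact Submodule.smul_mem _ _ hN

/-- A chain whose boundary is supported in `V` agrees with its iterated subdivisions up to
boundaries and chains supported in `V`. -/
lemma exists_eq_iterate_subdivide_add {V : Set X} (N : ℕ) (y : SingularChain (n + 1) X)
    (hy : boundary n X y ∈ within n V) : ∃ v ∈ within (n + 1) V, ∃ e,
      y = (subdivide (n + 1) X)^[N] y + v + boundary (n + 1) X e := by
  induction N generalizing y with
  | zero => exact ⟨0, Submodule.zero_mem _, 0, by simp⟩
  | succ N ih =>
    obtain ⟨v, hv, e, h⟩ := ih (subdivide (n + 1) X y)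
      (by rw [boundary_subdivide]; exact subdivide_mem_within hy)
    -- With S the subdivision and T the homotopy, y = Sy + T∂y + ∂Ty, and T∂y stays in `V` because
    -- ∂y does.
    refine ⟨v + subdivideHomotopy n X (boundary n X y),
      Submodule.add_mem _ hv (subdivideHomotopy_mem_within hy),
      e + subdivideHomotopy (n + 1) X y, ?_⟩
    have h' := boundary_subdivideHomotopy y
    rw [Function.iterate_succ_apply, map_add]
    rw [eq_sub_iff_add_eq] at h'
    nth_rewrite 1 [← h']
    nth_rewrite 1 [h]
    abel

/-- The small chains theorem for two open sets. -/
lemma exists_eq_add_add_boundary {U V : Set X} (hU : IsOpen U) (hV : IsOpen V)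
    (hUV : U ∪ V = Set.univ) (y : SingularChain (n + 1) X) (hy : boundary n X y ∈ within n V) :
    ∃ a ∈ within (n + 1) U, ∃ b ∈ within (n + 1) V, ∃ e, y = a + b + boundary (n + 1) X e := by
  obtain ⟨N, hN⟩ := exists_iterate_subdivide_mem hU hV hUV y
  obtain ⟨v, hv, e, h⟩ := exists_eq_iterate_subdivide_add N y hy
  obtain ⟨a, ha, b, hb, hab⟩ := Submodule.mem_sup.1 hN
  exact ⟨a, ha, b + v, Submodule.add_mem _ hb hv, e, by rw [h, ← hab, ← add_assoc]⟩

end SingularChain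

/-! ### Chains of subspaces and consequences of Mayer–Vietoris. -/

namespace SingularChain

variable {X : Type u} [TopologicalSpace X] {n : ℕ} {U V W : Set X}

/-- The inclusion of a subspace. -/
def incl (V : Set X) : C(V, X) := ⟨Subtype.val, continuous_subtype_val⟩

lemma incl_comp_inclusion (h : W ⊆ V) :
    (incl V).comp (ContinuousMap.inclusion h) = incl W := rfl

/-- Distinct simplices have distinct images, so a basis goes to part of a basis. -/
lemma push_injective {Y : Type u} [TopologicalSpace Y] {f : C(X, Y)}
    (hf : Function.Injective f) : Function.Injective (push n f) := by
  have h : LinearIndependent ℝ (push n f ∘ basis n X) := by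
    have : push n f ∘ basis n X = basis n Y ∘ fun σ ↦ f.comp σ := funext (push_basis f)
    rw [this]
    refine (basis n Y).linearIndependent.comp _ fun σ τ h ↦ ContinuousMap.ext fun x ↦ hf ?_
    exact congr($h x)
  exact LinearMap.injective_of_linearIndependent (basis n X).span_eq h

lemma push_incl_injective (V : Set X) : Function.Injective (push n (incl V)) :=
  push_injective Subtype.val_injective

lemma push_inclusion_injective (h : W ⊆ V) :
    Function.Injective (push n (ContinuousMap.inclusion h)) :=
  push_injective (Set.inclusion_injective h)

lemma push_incl_push_inclusion (h : W ⊆ V) (c : SingularChain n W) :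
    push n (incl V) (push n (ContinuousMap.inclusion h) c) = push n (incl W) c := by
  rw [← incl_comp_inclusion h, push_comp, LinearMap.comp_apply]

lemma exists_push_eq_of_mem_within {c : SingularChain n X} (hc : c ∈ within n V) :
    ∃ c' : SingularChain n V, push n (incl V) c' = c :=
  apply_mem_of_mem_within (W := LinearMap.range (push n (incl V))) LinearMap.id (fun σ hσ ↦
    ⟨basis n V ⟨fun x ↦ ⟨σ x, hσ x⟩, by fun_prop⟩, by rw [push_basis]; rfl⟩) hc

lemma push_incl_mem_within (c : SingularChain n V) : push n (incl V) c ∈ within n V := by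
  have : c ∈ within n (Set.univ : Set V) := by
    rw [within, show {σ : C(TopSimplex n, V) | Set.range σ ⊆ Set.univ} = Set.univ by simp,
      Set.image_univ, (basis n V).span_eq]
    trivial
  refine apply_mem_of_mem_within _ (fun σ _ ↦ ?_) this
  rw [push_basis]
  exact basis_mem_within fun x ↦ (σ x).2

/-- Simplices form a basis, so each simplex occurring in `c` lies in both `U` and `V`. -/
lemma mem_within_inter {c : SingularChain n X} (hU : c ∈ within n U) (hV : c ∈ within n V) :
    c ∈ within n (U ∩ V) := by
  rw [within, Module.Basis.mem_span_image] at hU hV ⊢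
  exact fun σ hσ ↦ Set.subset_inter (hU hσ) (hV hσ)

end SingularChain

namespace Homology

open SingularChain

variable {X : Type u} [TopologicalSpace X] {n : ℕ} {U V : Set X}

/-- A consequence of the exactness of the Mayer–Vietoris sequence at the homology of the space. -/
lemma map_incl_surjective (hU : IsOpen U) (hV : IsOpen V) (hUV : U ∪ V = Set.univ)
    (hU' : Subsingleton (Homology (n + 1) U))
    (hW : Function.Injective
      (Homology.map n (ContinuousMap.inclusion (Set.inter_subset_right (s := U) (t := V))))) :
    Function.Surjective (Homology.map (n + 1) (incl V)) := by
  rw [map_surjective_iff]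
  rw [map_injective_iff] at hW
  rw [subsingleton_iff] at hU'
  intro z hz
  rw [isCycle_succ_iff] at hz
  obtain ⟨a, ha, b, hb, e, rfl⟩ := exists_eq_add_add_boundary hU hV hUV z
    (by rw [hz]; exact Submodule.zero_mem _)
  rw [map_add, map_add, boundary_boundary, add_zero] at hz
  have hab : boundary n X a = - boundary n X b := eq_neg_of_add_eq_zero_left hz
  -- The chain ∂a = −∂b lies in both open sets, so it comes from a cycle `w` of the intersection.
  -- This `w` represents the image of `z` under the connecting map.
  obtain ⟨w, hw⟩ := exists_push_eq_of_mem_within (mem_within_inter (boundary_mem_within ha)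
    (hab ▸ Submodule.neg_mem _ (boundary_mem_within hb)))
  obtain ⟨a, rfl⟩ := exists_push_eq_of_mem_within ha
  obtain ⟨b, rfl⟩ := exists_push_eq_of_mem_within hb
  have hwV : push n (ContinuousMap.inclusion Set.inter_subset_right) w = - boundary n V b := by
    apply push_incl_injective V
    rw [push_incl_push_inclusion, hw, hab, boundary_push, map_neg]
  have hwU : push n (ContinuousMap.inclusion Set.inter_subset_left) w = boundary n U a := by
    apply push_incl_injective U
    rw [push_incl_push_inclusion, hw, boundary_push]
  have hwc : IsCycle w := .of_push (fun m ↦ push_inclusion_injective Set.inter_subset_left)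
    (hwU ▸ isCycle_boundary a)
  -- Since `w` bounds in `V`, injectivity makes it bound a chain `c` in the intersection. Then a − c
  -- is a cycle of `U`, hence some ∂e', and z = (b + c) + ∂(e + e') with b + c a cycle of `V`.
  obtain ⟨c, rfl⟩ := hW w hwc ⟨-b, by rw [hwV, map_neg]⟩
  rw [← boundary_push] at hwU hwV
  obtain ⟨e', he'⟩ := hU' (a - push (n + 1) (ContinuousMap.inclusion Set.inter_subset_left) c)
    (isCycle_succ_iff.2 (by rw [map_sub, hwU, sub_self]))
  refine ⟨b + push (n + 1) (ContinuousMap.inclusion Set.inter_subset_right) c,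
    isCycle_succ_iff.2 (by rw [map_add, hwV, add_neg_cancel]), e + push (n + 2) (incl U) e', ?_⟩
  rw [map_add, map_add, boundary_push, he', map_sub, push_incl_push_inclusion,
    push_incl_push_inclusion]
  abel

/-- A consequence of the exactness of the Mayer–Vietoris sequence at the sum of the homologies of
the two open sets. -/
lemma map_incl_injective (hU : IsOpen U) (hV : IsOpen V) (hUV : U ∪ V = Set.univ)
    (hW : Subsingleton (Homology n (U ∩ V : Set X))) :
    Function.Injective (Homology.map n (incl V)) := by
  rw [map_injective_iff]
  rw [subsingleton_iff] at hW
  rintro x hx ⟨y, hy⟩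
  -- The chain `y` is not a cycle, but its boundary lies in `V`, which is all that the small chains
  -- theorem requires.
  obtain ⟨a, ha, b, hb, e, rfl⟩ := exists_eq_add_add_boundary hU hV hUV y
    (by rw [hy]; exact push_incl_mem_within x)
  rw [map_add, map_add, boundary_boundary, add_zero] at hy
  have hab : boundary n X a = push n (incl V) x - boundary n X b := eq_sub_of_add_eq hy
  obtain ⟨w, hw⟩ := exists_push_eq_of_mem_within (mem_within_inter (boundary_mem_within ha)
    (hab ▸ Submodule.sub_mem _ (push_incl_mem_within x) (boundary_mem_within hb)))
  obtain ⟨a, rfl⟩ := exists_push_eq_of_mem_within ha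
  obtain ⟨b, rfl⟩ := exists_push_eq_of_mem_within hb
  have hwV : push n (ContinuousMap.inclusion Set.inter_subset_right) w = x - boundary n V b := by
    apply push_incl_injective V
    rw [push_incl_push_inclusion, hw, hab, boundary_push, map_sub]
  have hwU : push n (ContinuousMap.inclusion Set.inter_subset_left) w = boundary n U a := by
    apply push_incl_injective U
    rw [push_incl_push_inclusion, hw, boundary_push]
  have hwc : IsCycle w := .of_push (fun m ↦ push_inclusion_injective Set.inter_subset_left)
    (hwU ▸ isCycle_boundary a)
  -- The difference x − ∂b = ∂a comes from a cycle of the intersection, which bounds `c`; hence x =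
  -- ∂(c + b) in `V`.
  obtain ⟨c, rfl⟩ := hW w hwc
  refine ⟨push (n + 1) (ContinuousMap.inclusion Set.inter_subset_right) c + b, ?_⟩
  rw [map_add, boundary_push, hwV, sub_add_cancel]

end Homology

/-! ### Homotopy invariance and reduced homology. -/

namespace Homology

open SingularChain

variable {X Y : Type u} [TopologicalSpace X] [TopologicalSpace Y] {n : ℕ}

lemma map_bijective_of_homotopy_inverse {i : C(X, Y)} {r : C(Y, X)}
    (hri : (r.comp i).Homotopic (ContinuousMap.id X))
    (hir : (i.comp r).Homotopic (ContinuousMap.id Y)) : Function.Bijective (Homology.map n i) := by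
  have h1 := map_eq_of_homotopic (n := n) hri
  have h2 := map_eq_of_homotopic (n := n) hir
  rw [map_comp, map_id] at h1 h2
  exact Function.bijective_iff_has_inverse.2
    ⟨Homology.map n r, fun x ↦ congr($h1 x), fun y ↦ congr($h2 y)⟩

lemma subsingleton_of_isEmpty [IsEmpty X] : Subsingleton (Homology n X) := by
  have : IsEmpty C(TopSimplex n, X) := ⟨fun σ ↦ isEmptyElim (σ (Classical.arbitrary _))⟩
  have : Subsingleton (SingularChain n X) := (basis n X).repr.toEquiv.subsingleton
  exact subsingleton_iff.2 fun z _ ↦ ⟨0, Subsingleton.elim _ _⟩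

lemma subsingleton_punit : Subsingleton (Homology (n + 1) PUnit.{u + 1}) := by
  have h := AlgebraicTopology.isZero_singularHomologyFunctor_of_totallyDisconnectedSpace
    (ModuleCat.{u} ℝ) (n + 1) (ModuleCat.of ℝ (ULift.{u} ℝ)) (TopCat.of PUnit.{u + 1})
    n.succ_ne_zero
  exact ModuleCat.subsingleton_of_isZero h

/-- On homology the identity factors through a point, whose homology vanishes in positive degrees.
-/
lemma subsingleton_of_homotopic_const {p : X}
    (h : (ContinuousMap.id X).Homotopic (ContinuousMap.const X p)) :
    Subsingleton (Homology (n + 1) X) := by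
  have e : ContinuousMap.const X p =
    (ContinuousMap.const PUnit.{u + 1} p).comp (ContinuousMap.const X PUnit.unit) := rfl
  have h' := map_eq_of_homotopic (n := n + 1) h
  rw [map_id, e, map_comp] at h'
  have := subsingleton_punit.{u} (n := n)
  refine subsingleton_of_forall_eq 0 fun x ↦ ?_
  have hx := congr($h' x)
  rw [LinearMap.id_apply, LinearMap.comp_apply, Subsingleton.elim (Homology.map (n + 1) _ x) 0,
    map_zero] at hx
  exact hx

end Homology

namespace ReducedHomology

variable {X : Type u} [TopologicalSpace X] {n : ℕ}

/-- In positive degrees reduced homology agrees with homology. -/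
noncomputable def equivHomology (n : ℕ) (X : Type u) [TopologicalSpace X] :
    ReducedHomology (n + 1) X ≃ₗ[ℝ] Homology (n + 1) X :=
  LinearEquiv.ofTop _ <| by
    have := Homology.subsingleton_punit.{u} (n := n)
    exact Submodule.eq_top_iff'.2 fun x ↦ LinearMap.mem_ker.2 (Subsingleton.elim _ _)

/-- Both degree-zero groups are one-dimensional, and any point of `X` splits the map to a point. The
map is therefore onto, and so injective by dimension. -/
lemma subsingleton_zero [PathConnectedSpace X] : Subsingleton (ReducedHomology 0 X) := by
  have e (Z : Type u) [TopologicalSpace Z] [PathConnectedSpace Z] :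
      Nonempty (Homology 0 Z ≃ₗ[ℝ] ℝ) := by
    have : PathConnectedSpace (TopCat.of Z) := ‹_›
    exact ⟨(CategoryTheory.asIso (TopCat.singularHomology₀ε (TopCat.of Z)
      (ModuleCat.of ℝ (ULift.{u} ℝ)))).toLinearEquiv.trans ULift.moduleEquiv⟩
  obtain ⟨e₁⟩ := e X
  obtain ⟨e₂⟩ := e PUnit.{u + 1}
  have := Module.Finite.equiv e₁.symm
  have := Module.Finite.equiv e₂.symm
  obtain ⟨p⟩ := (inferInstance : Nonempty X)
  have hs : Function.Surjective (Homology.map 0 (ContinuousMap.const X PUnit.unit.{u + 1})) := by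
    have h : Homology.map 0 ((ContinuousMap.const X PUnit.unit.{u + 1}).comp
        (ContinuousMap.const PUnit.{u + 1} p)) = LinearMap.id := Homology.map_id
    rw [Homology.map_comp] at h
    exact fun y ↦ ⟨_, congr($h y)⟩
  have hi := (LinearMap.injective_iff_surjective_of_finrank_eq_finrank
    (e₁.finrank_eq.trans e₂.finrank_eq.symm)).2 hs
  rw [ReducedHomology, LinearMap.ker_eq_bot.2 hi]
  infer_instance

end ReducedHomology

/-! ### Maps and deformations of the intersection space. -/

namespace IntersectionSpace

open Topology unitInterval

variable {A L : Type u} [TopologicalSpace A] [TopologicalSpace L] {f : C(A, L)}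

/-- The map from the collar `L × [0,1)` to the intersection space. -/
def collar (f : C(A, L)) : C(L × Set.Ico (0 : ℝ) 1, IntersectionSpace f) :=
  ⟨fun p ↦ Quot.mk _ (Sum.inl p), by fun_prop⟩

/-- The map from the cylinder `[0,1] × A` to the intersection space. -/
def cone (f : C(A, L)) : C(I × A, IntersectionSpace f) :=
  ⟨fun q ↦ Quot.mk _ (Sum.inr (Quot.mk _ q)), by fun_prop⟩

lemma collar_zero (a : A) : collar f (f a, ⟨0, le_rfl, one_pos⟩) = cone f (0, a) :=
  Quot.sound (GluingRel.glue a)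

lemma cone_one (a a' : A) : cone f (1, a) = cone f (1, a') :=
  congrArg (fun c ↦ Quot.mk _ (Sum.inr c)) (Quot.sound (ConeRel.vertex a a'))

lemma eq_collar_or_eq_cone (x : IntersectionSpace f) :
    (∃ p, x = collar f p) ∨ ∃ q, x = cone f q := by
  obtain ⟨p | c, rfl⟩ := Quot.exists_rep x
  · exact .inl ⟨p, rfl⟩
  · obtain ⟨q, rfl⟩ := Quot.exists_rep c
    exact .inr ⟨q, rfl⟩

/-- The two successive quotients combine into one, so continuity need only be tested on the collar
and the cylinder. -/
lemma isQuotientMap_sumElim : IsQuotientMap (Sum.elim (collar f) (cone f)) where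
  eq_coinduced := by
    ext s
    have h := isQuotientMap_quot_mk.isOpen_preimage (f := Quot.mk (ConeRel A))
      (s := Sum.inr ⁻¹' (Quot.mk (GluingRel f) ⁻¹' s))
    rw [← isQuotientMap_quot_mk.isOpen_preimage (f := Quot.mk (GluingRel f)), isOpen_sum_iff, ← h]
    rfl
  surjective x := by
    rcases eq_collar_or_eq_cone x with ⟨p, rfl⟩ | ⟨q, rfl⟩
    · exact ⟨.inl p, rfl⟩
    · exact ⟨.inr q, rfl⟩

section Lift

variable {Z : Type*}

/-- A map on the intersection space given by compatible maps on the collar and the cylinder. -/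
def lift (g : L × Set.Ico (0 : ℝ) 1 → Z) (h : I × A → Z) (hv : ∀ a a', h (1, a) = h (1, a'))
    (hg : ∀ a, g (f a, ⟨0, le_rfl, one_pos⟩) = h (0, a)) : IntersectionSpace f → Z :=
  Quot.lift (Sum.elim g (Quot.lift h (by rintro _ _ ⟨a, a'⟩; exact hv a a')))
    (by rintro _ _ ⟨a⟩; exact hg a)

variable {g : L × Set.Ico (0 : ℝ) 1 → Z} {h : I × A → Z} {hv : ∀ a a', h (1, a) = h (1, a')}
  {hg : ∀ a, g (f a, ⟨0, le_rfl, one_pos⟩) = h (0, a)}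

variable [TopologicalSpace Z]

lemma continuous_lift (hgc : Continuous g) (hhc : Continuous h) : Continuous (lift g h hv hg) :=
  isQuotientMap_sumElim.continuous_iff.2 (continuous_sum_dom.2 ⟨hgc, hhc⟩)

/-- This serves retractions defined only on an open part, which are extended by arbitrary values and
may be discontinuous elsewhere. -/
lemma continuousOn_lift {V : Set (IntersectionSpace f)} (hV : IsOpen V)
    (hgc : ∀ p, collar f p ∈ V → ContinuousAt g p) (hhc : ∀ q, cone f q ∈ V → ContinuousAt h q) :
    ContinuousOn (lift g h hv hg) V := by
  rw [isQuotientMap_sumElim.continuousOn_isOpen_iff hV]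
  rintro (p | q) hx
  · exact ((IsOpenEmbedding.inl.continuousAt_iff
      (g := lift g h hv hg ∘ Sum.elim (collar f) (cone f))).1 (hgc p hx)).continuousWithinAt
  · exact ((IsOpenEmbedding.inr.continuousAt_iff
      (g := lift g h hv hg ∘ Sum.elim (collar f) (cone f))).1 (hhc q hx)).continuousWithinAt

/-- A homotopy on the intersection space given by compatible homotopies on the collar and the
cylinder. -/
def liftHomotopy (G : C((L × Set.Ico (0 : ℝ) 1) × I, Z)) (H : C((I × A) × I, Z))
    (hv : ∀ a a' s, H ((1, a), s) = H ((1, a'), s))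
    (hg : ∀ a s, G ((f a, ⟨0, le_rfl, one_pos⟩), s) = H ((0, a), s)) :
    C(IntersectionSpace f × I, Z) :=
  -- Descending maps into the path space `C(I, Z)` avoids proving that the quotient map times `I` is
  -- a quotient map; local compactness of `I` allows uncurrying.
  ContinuousMap.uncurry ⟨lift G.curry H.curry (fun a a' ↦ ContinuousMap.ext (hv a a'))
    fun a ↦ ContinuousMap.ext (hg a), continuous_lift G.curry.continuous H.curry.continuous⟩

end Lift

/-- The height function, which vanishes on the collar and is the cone coordinate on the cone. -/
def height (f : C(A, L)) : IntersectionSpace f → ℝ :=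
  lift (fun _ ↦ 0) (fun q ↦ (q.1 : ℝ)) (fun _ _ ↦ rfl) (fun _ ↦ rfl)

lemma continuous_height : Continuous (height f) :=
  continuous_lift continuous_const (by fun_prop)

section Deform

variable (p : ℝ → ℝ) (hp : Continuous p) (h0 : p 0 ≤ 0) (h1 : 1 ≤ p 1)

/-- The deformation of the intersection space which shrinks the collar and deforms the cone
coordinate `t` linearly to `p t`. -/
noncomputable def deform (f : C(A, L)) : C(IntersectionSpace f × I, IntersectionSpace f) :=
  liftHomotopy
    ⟨fun x ↦ collar f (x.1.1, ⟨σ x.2 * x.1.2, mul_nonneg (σ x.2).2.1 x.1.2.2.1,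
      (mul_le_of_le_one_left x.1.2.2.1 (σ x.2).2.2).trans_lt x.1.2.2.2⟩), by fun_prop⟩
    -- Clamping to `[0,1]` allows `p` to leave the interval. The bounds `p 0 ≤ 0` and `1 ≤ p 1` then
    -- fix the base and the vertex at all times.
    ⟨fun x ↦ cone f (Set.projIcc 0 1 zero_le_one ((1 - x.2 : ℝ) * x.1.1 + x.2 * p x.1.1), x.1.2), by
      refine (cone f).continuous.comp (.prodMk (continuous_projIcc.comp ?_) (by fun_prop))
      fun_prop⟩
    (fun a a' s ↦ by
      have : Set.projIcc (0 : ℝ) 1 zero_le_one ((1 - s : ℝ) * (1 : I) + s * p (1 : I)) = 1 := by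
        apply Set.projIcc_of_right_le
        have := mul_le_mul_of_nonneg_left h1 s.2.1
        simp only [Set.Icc.coe_one]
        linarith
      simp only [ContinuousMap.coe_mk, this]
      exact cone_one a a')
    (fun a s ↦ by
      have : Set.projIcc (0 : ℝ) 1 zero_le_one ((1 - s : ℝ) * (0 : I) + s * p (0 : I)) = 0 := by
        apply Set.projIcc_of_le_left
        have := mul_nonpos_of_nonneg_of_nonpos s.2.1 h0
        simp only [Set.Icc.coe_zero]
        linarith
      simp only [ContinuousMap.coe_mk, this]
      rw [← collar_zero]
      congr 3
      exact mul_zero _)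

lemma deform_collar (x : L × Set.Ico (0 : ℝ) 1) (s : I) :
    deform p hp h0 h1 f (collar f x, s) = collar f (x.1, ⟨σ s * x.2, mul_nonneg (σ s).2.1 x.2.2.1,
      (mul_le_of_le_one_left x.2.2.1 (σ s).2.2).trans_lt x.2.2.2⟩) := rfl

lemma deform_cone (x : I × A) (s : I) : deform p hp h0 h1 f (cone f x, s) =
    cone f (Set.projIcc 0 1 zero_le_one ((1 - s : ℝ) * x.1 + s * p x.1), x.2) := rfl

lemma deform_zero (x : IntersectionSpace f) : deform p hp h0 h1 f (x, 0) = x := by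
  rcases eq_collar_or_eq_cone x with ⟨x, rfl⟩ | ⟨x, rfl⟩
  · rw [deform_collar]
    congr 2
    ext
    simp
  · rw [deform_cone]
    congr 2
    simp

lemma deform_cone_one (x : I × A) : deform p hp h0 h1 f (cone f x, 1) =
    cone f (Set.projIcc 0 1 zero_le_one (p x.1), x.2) := by
  rw [deform_cone]
  congr 2
  simp

/-- Different choices of `p` make this apply to the upper part, the lower part and their
intersection. -/
lemma homotopic_of_deform {V : Set (IntersectionSpace f)}
    (hV : ∀ x ∈ V, ∀ s, deform p hp h0 h1 f (x, s) ∈ V) {g : C(V, V)}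
    (hg : ∀ x (hx : x ∈ V), (g ⟨x, hx⟩).1 = deform p hp h0 h1 f (x, 1)) :
    g.Homotopic (ContinuousMap.id V) :=
  .symm ⟨{
    toFun y := ⟨deform p hp h0 h1 f (y.2, y.1), hV y.2 y.2.2 y.1⟩
    continuous_toFun := by fun_prop
    map_zero_left x := Subtype.ext (deform_zero p hp h0 h1 x.1)
    map_one_left x := Subtype.ext (hg x.1 x.2).symm }⟩

end Deform

end IntersectionSpace

/-! ### The two open parts, their intersection, and their homotopy types. -/

namespace IntersectionSpace

open Topology unitInterval SingularChain

variable {A L : Type u} [TopologicalSpace A] [TopologicalSpace L] {f : C(A, L)} {n : ℕ}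

/-- The points of the intersection space above height `1 / 3`. -/
def upper (f : C(A, L)) : Set (IntersectionSpace f) := {x | 1 / 3 < height f x}

/-- The points of the intersection space below height `2 / 3`. -/
def lower (f : C(A, L)) : Set (IntersectionSpace f) := {x | height f x < 2 / 3}

lemma isOpen_upper : IsOpen (upper f) := isOpen_lt continuous_const continuous_height

lemma isOpen_lower : IsOpen (lower f) := isOpen_lt continuous_height continuous_const

lemma upper_union_lower : upper f ∪ lower f = Set.univ := by
  refine Set.eq_univ_of_forall fun x ↦ ?_
  rcases lt_or_ge (1 / 3) (height f x) with h | h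
  · exact .inl h
  · exact .inr (h.trans_lt (by norm_num))

lemma collar_notMem_upper (p : L × Set.Ico (0 : ℝ) 1) : collar f p ∉ upper f := fun h ↦ by
  have : (1 / 3 : ℝ) < 0 := h
  norm_num at this

lemma collar_mem_lower (p : L × Set.Ico (0 : ℝ) 1) : collar f p ∈ lower f :=
  show (0 : ℝ) < 2 / 3 by norm_num

lemma cone_mem_upper_iff {q : I × A} : cone f q ∈ upper f ↔ 1 / 3 < (q.1 : ℝ) := Iff.rfl

lemma cone_mem_lower_iff {q : I × A} : cone f q ∈ lower f ↔ (q.1 : ℝ) < 2 / 3 := Iff.rfl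

section Deform

variable {p : ℝ → ℝ} {hp : Continuous p} {h0 : p 0 ≤ 0} {h1 : 1 ≤ p 1} {q : I × A} {s : I}

lemma deform_cone_mem_upper (h : 1 / 3 < (1 - s : ℝ) * q.1 + s * p q.1) :
    deform p hp h0 h1 f (cone f q, s) ∈ upper f :=
  lt_max_of_lt_right (lt_min (by norm_num) h)

lemma deform_cone_mem_lower (h : (1 - s : ℝ) * q.1 + s * p q.1 < 2 / 3) :
    deform p hp h0 h1 f (cone f q, s) ∈ lower f :=
  max_lt (by norm_num) (min_lt_of_right_lt h)

end Deform

lemma isEmpty_upper [IsEmpty A] : IsEmpty (upper f) := by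
  refine ⟨fun ⟨x, hx⟩ ↦ ?_⟩
  rcases eq_collar_or_eq_cone x with ⟨x, rfl⟩ | ⟨x, rfl⟩
  · exact collar_notMem_upper x hx
  · exact isEmptyElim x.2

/-- The function `3 * t` exceeds `1` for `t > 1/3`, so after clamping the deformation ends at the
cone vertex and never lowers the height. With `A` empty there is no vertex, but then the upper part
is empty. -/
lemma subsingleton_homology_upper : Subsingleton (Homology (n + 1) (upper f)) := by
  rcases isEmpty_or_nonempty A with hA | ⟨⟨a⟩⟩
  · have := isEmpty_upper (f := f)
    exact Homology.subsingleton_of_isEmpty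
  have hU : ∀ x ∈ upper f, ∀ s, deform (fun t ↦ 3 * t) (by fun_prop) (by simp) (by norm_num) f
      (x, s) ∈ upper f := fun x hx s ↦ by
    rcases eq_collar_or_eq_cone x with ⟨x, rfl⟩ | ⟨x, rfl⟩
    · exact (collar_notMem_upper x hx).elim
    · rw [cone_mem_upper_iff] at hx
      exact deform_cone_mem_upper (by nlinarith [s.2.1])
  refine Homology.subsingleton_of_homotopic_const
    (p := ⟨cone f (1, a), show (1 / 3 : ℝ) < 1 by norm_num⟩)
    (homotopic_of_deform _ _ _ _ hU fun x hx ↦ ?_).symm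
  rcases eq_collar_or_eq_cone x with ⟨x, rfl⟩ | ⟨x, rfl⟩
  · exact (collar_notMem_upper x hx).elim
  · rw [cone_mem_upper_iff] at hx
    rw [deform_cone_one, Set.projIcc_of_right_le zero_le_one (by linarith)]
    exact cone_one _ _

variable (f) in
/-- The inclusion of `L` into the lower part as the boundary of the collar. -/
def toLower : C(L, lower f) :=
  ⟨fun x ↦ ⟨collar f (x, ⟨0, le_rfl, one_pos⟩), collar_mem_lower _⟩, by fun_prop⟩

lemma toLower_bijective [Nonempty L] :
    Function.Bijective (Homology.map n (toLower f)) := by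
  classical
  obtain ⟨x₀⟩ := (inferInstance : Nonempty L)
  -- The value `x₀` at the vertex only makes the map well defined; the vertex lies outside the lower
  -- part.
  let r : IntersectionSpace f → L := lift Prod.fst (fun q ↦ if q.1 = 1 then x₀ else f q.2)
    (fun a a' ↦ by simp) (fun a ↦ by simp)
  have hr : ContinuousOn r (lower f) := by
    refine continuousOn_lift isOpen_lower (fun p _ ↦ continuousAt_fst) fun q hq ↦ ?_
    refine (f.continuous.comp continuous_snd).continuousAt.congr ?_
    have : {q : I × A | (q.1 : ℝ) < 2 / 3} ∈ 𝓝 q :=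
      (isOpen_lt (by fun_prop) continuous_const).mem_nhds hq
    filter_upwards [this] with q' hq'
    have h1 : q'.1 ≠ 1 := fun h ↦ by
      have h' : (q'.1 : ℝ) < 2 / 3 := hq'
      rw [h] at h'
      norm_num at h'
    simp [h1]
  -- For `t < 2/3` the value `3 * t - 2` is negative and is clamped to `0`, so the cone part is
  -- pushed to its base.
  have hV : ∀ x ∈ lower f, ∀ s, deform (fun t ↦ 3 * t - 2) (by fun_prop) (by simp) (by norm_num) f
      (x, s) ∈ lower f := fun x hx s ↦ by
    rcases eq_collar_or_eq_cone x with ⟨x, rfl⟩ | ⟨x, rfl⟩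
    · exact collar_mem_lower _
    · rw [cone_mem_lower_iff] at hx
      exact deform_cone_mem_lower (by nlinarith [s.2.1])
  refine Homology.map_bijective_of_homotopy_inverse (r := ⟨(lower f).domRestrict r, hr.domRestrict⟩)
    (.refl _) (homotopic_of_deform _ _ _ _ hV fun x hx ↦ ?_)
  rcases eq_collar_or_eq_cone x with ⟨x, rfl⟩ | ⟨x, rfl⟩
  · rw [deform_collar]
    refine congrArg (collar f) (Prod.ext rfl (Subtype.ext ?_))
    simp
  · rw [cone_mem_lower_iff] at hx
    rw [deform_cone_one, Set.projIcc_of_le_left zero_le_one (by linarith)]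
    have h1 : x.1 ≠ 1 := fun h ↦ by
      rw [h] at hx
      norm_num at hx
    refine Eq.trans ?_ (collar_zero x.2)
    refine congrArg (collar f) (Prod.ext ?_ rfl)
    exact if_neg h1

/-- The inclusion of `A` into the intersection of the upper and the lower part. -/
noncomputable def toMiddle (f : C(A, L)) : C(A, (upper f ∩ lower f : Set _)) :=
  ⟨fun a ↦ ⟨cone f (⟨1 / 2, by norm_num, by norm_num⟩, a),
    show (1 / 3 : ℝ) < 1 / 2 by norm_num, show (1 / 2 : ℝ) < 2 / 3 by norm_num⟩, by fun_prop⟩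

lemma toMiddle_bijective : Function.Bijective (Homology.map n (toMiddle f)) := by
  classical
  rcases isEmpty_or_nonempty A with hA | ⟨⟨a₀⟩⟩
  · have := isEmpty_upper (f := f)
    have : IsEmpty (upper f ∩ lower f : Set _) := ⟨fun x ↦ isEmptyElim (⟨x, x.2.1⟩ : upper f)⟩
    have := Homology.subsingleton_of_isEmpty (X := A) (n := n)
    have := Homology.subsingleton_of_isEmpty (X := (upper f ∩ lower f : Set _)) (n := n)
    exact ⟨Function.injective_of_subsingleton _, fun y ↦ ⟨0, Subsingleton.elim _ _⟩⟩
  -- The constant `a₀` at heights `0` and `1` makes the projection to `A` compatible with both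
  -- identifications; neither height occurs in the intersection.
  let r : IntersectionSpace f → A := lift (fun _ ↦ a₀)
    (fun q ↦ if q.1 = 1 ∨ q.1 = 0 then a₀ else q.2) (fun a a' ↦ by simp) (fun a ↦ by simp)
  have hne : ∀ q : I × A, 1 / 3 < (q.1 : ℝ) → (q.1 : ℝ) < 2 / 3 → ¬ (q.1 = 1 ∨ q.1 = 0) := by
    rintro q h1 h2 (h | h)
    · rw [h] at h2
      norm_num at h2
    · rw [h] at h1
      norm_num at h1
  have hr : ContinuousOn r (upper f ∩ lower f) := by
    refine continuousOn_lift (isOpen_upper.inter isOpen_lower)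
      (fun p _ ↦ continuousAt_const) fun q hq ↦ ?_
    refine continuousAt_snd.congr ?_
    have : {q : I × A | 1 / 3 < (q.1 : ℝ) ∧ (q.1 : ℝ) < 2 / 3} ∈ 𝓝 q :=
      ((isOpen_upper.inter isOpen_lower).preimage (cone f).continuous).mem_nhds hq
    filter_upwards [this] with q' hq'
    exact (if_neg (hne q' hq'.1 hq'.2)).symm
  -- Piecewise linear from `0` to `1`, with the constant value `1/2` on `[1/3, 2/3]`, so the
  -- intersection is flattened onto the slice at height `1/2`.
  let p : ℝ → ℝ := fun t ↦ max (min (3 / 2 * t) (1 / 2)) ((3 * t - 1) / 2)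
  have hp : ∀ t, 1 / 3 < t → t < 2 / 3 → p t = 1 / 2 := fun t h1 h2 ↦ by
    simp only [p]
    rw [min_eq_right (by linarith), max_eq_left (by linarith)]
  have hW : ∀ x ∈ upper f ∩ lower f, ∀ s, deform p (by fun_prop) (by simp [p]; norm_num)
      (by simp [p]; norm_num) f (x, s) ∈ upper f ∩ lower f := fun x hx s ↦ by
    rcases eq_collar_or_eq_cone x with ⟨x, rfl⟩ | ⟨x, rfl⟩
    · exact (collar_notMem_upper x hx.1).elim
    · have h1 := cone_mem_upper_iff.1 hx.1
      have h2 := cone_mem_lower_iff.1 hx.2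
      have h3 := s.2.1
      have h4 := s.2.2
      constructor
      · refine deform_cone_mem_upper ?_
        rw [hp _ h1 h2]
        nlinarith
      · refine deform_cone_mem_lower ?_
        rw [hp _ h1 h2]
        nlinarith
  refine Homology.map_bijective_of_homotopy_inverse
    (r := ⟨(upper f ∩ lower f).domRestrict r, hr.domRestrict⟩)
    ?_ (homotopic_of_deform _ _ _ _ hW fun x hx ↦ ?_)
  · suffices h : ∀ a, r (cone f (⟨1 / 2, by norm_num, by norm_num⟩, a)) = a by
      have e : ContinuousMap.comp ⟨(upper f ∩ lower f).domRestrict r, hr.domRestrict⟩ (toMiddle f) =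
        ContinuousMap.id A := ContinuousMap.ext h
      rw [e]
    exact fun a ↦ if_neg (hne _ (by norm_num) (by norm_num))
  · rcases eq_collar_or_eq_cone x with ⟨x, rfl⟩ | ⟨x, rfl⟩
    · exact (collar_notMem_upper x hx.1).elim
    · have h1 := cone_mem_upper_iff.1 hx.1
      have h2 := cone_mem_lower_iff.1 hx.2
      rw [deform_cone_one, hp _ h1 h2,
        Set.projIcc_of_mem zero_le_one (show (1 / 2 : ℝ) ∈ Set.Icc 0 1 by norm_num)]
      exact congrArg (cone f) (Prod.ext rfl (if_neg (hne x h1 h2)))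

/-- Slide along the cone lines from the base, glued to the collar by `f`, up to height `1/2`. -/
lemma toLower_comp_homotopic : ((toLower f).comp f).Homotopic
    ((ContinuousMap.inclusion Set.inter_subset_right).comp (toMiddle f)) := by
  have hm : ∀ x : I × A, cone f (⟨x.1 / 2, by linarith [x.1.2.1], by linarith [x.1.2.2]⟩, x.2) ∈
      lower f := fun x ↦ by
    change (x.1 / 2 : ℝ) < 2 / 3
    linarith [x.1.2.2]
  refine ⟨⟨⟨fun x ↦ ⟨_, hm x⟩, Continuous.subtype_mk ((cone f).continuous.comp (by fun_prop)) _⟩,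
    fun a ↦ Subtype.ext ?_, fun a ↦ rfl⟩⟩
  refine Eq.trans ?_ (collar_zero a).symm
  refine congrArg (cone f) (Prod.ext (Subtype.ext ?_) rfl)
  simp

instance [PathConnectedSpace L] : PathConnectedSpace (IntersectionSpace f) := by
  have : PathConnectedSpace (Set.Ico (0 : ℝ) 1) :=
    isPathConnected_iff_pathConnectedSpace.1 ((convex_Ico 0 1).isPathConnected ⟨0, by simp⟩)
  have x₀ : L := Classical.arbitrary L
  have hc : ∀ x y, Joined (collar f x) (collar f y) := fun x y ↦
    (PathConnectedSpace.joined x y).map (collar f).continuous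
  have key : ∀ x, Joined (collar f (x₀, ⟨0, le_rfl, one_pos⟩)) x := fun x ↦ by
    rcases eq_collar_or_eq_cone x with ⟨x, rfl⟩ | ⟨⟨t, a⟩, rfl⟩
    · exact hc _ _
    · have h := hc (x₀, ⟨0, le_rfl, one_pos⟩) (f a, ⟨0, le_rfl, one_pos⟩)
      rw [collar_zero] at h
      have : PathConnectedSpace I :=
        isPathConnected_iff_pathConnectedSpace.1 ((convex_Icc 0 1).isPathConnected ⟨0, by simp⟩)
      exact h.trans ((PathConnectedSpace.joined (0 : I) t).map (f := fun s ↦ cone f (s, a))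
        (by fun_prop))
  exact ⟨⟨collar f (x₀, ⟨0, le_rfl, one_pos⟩)⟩, fun x y ↦ (key x).symm.trans (key y)⟩

end IntersectionSpace

/-- Below `k` the map is an isomorphism; from `k` on its source is zero. -/
lemma IsMooreApproximation.injective {A L : Type u} [TopologicalSpace A] [TopologicalSpace L]
    {f : C(A, L)} {k : ℤ} (hf : IsMooreApproximation k f) (n : ℕ) :
    Function.Injective (Homology.map n f) := by
  rcases lt_or_ge (n : ℤ) k with h | h
  · exact (hf.bijective_of_lt n h).1
  · have := hf.subsingleton_of_le n h
    exact Function.injective_of_subsingleton _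

/-! ### Homology of the intersection space and the theorem. -/

namespace IntersectionSpace

open SingularChain

variable {A L : Type u} [TopologicalSpace A] [TopologicalSpace L] {f : C(A, L)} {n : ℕ}

/-- This identifies the inclusion of the intersection into the lower part with `f` on homology, so
injectivity and surjectivity transfer from `f`. -/
lemma map_inclusion_comp_toMiddle :
    Homology.map n (ContinuousMap.inclusion
      (Set.inter_subset_right (s := upper f) (t := lower f))) ∘ₗ Homology.map n (toMiddle f) =
    Homology.map n (toLower f) ∘ₗ Homology.map n f := by
  rw [← Homology.map_comp, ← Homology.map_comp,
    Homology.map_eq_of_homotopic toLower_comp_homotopic]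

lemma map_inclusion_injective [Nonempty L] (hf : Function.Injective (Homology.map n f)) :
    Function.Injective (Homology.map n (ContinuousMap.inclusion
      (Set.inter_subset_right (s := upper f) (t := lower f)))) := by
  intro x y hxy
  obtain ⟨a, rfl⟩ := toMiddle_bijective.2 x
  obtain ⟨b, rfl⟩ := toMiddle_bijective.2 y
  have ha := LinearMap.congr_fun (map_inclusion_comp_toMiddle (f := f) (n := n)) a
  have hb := LinearMap.congr_fun (map_inclusion_comp_toMiddle (f := f) (n := n)) b
  rw [LinearMap.comp_apply, LinearMap.comp_apply] at ha hb
  rw [hf (toLower_bijective.1 (ha.symm.trans (hxy.trans hb)))]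

lemma map_inclusion_surjective [Nonempty L] (hf : Function.Surjective (Homology.map n f)) :
    Function.Surjective (Homology.map n (ContinuousMap.inclusion
      (Set.inter_subset_right (s := upper f) (t := lower f)))) := by
  intro y
  obtain ⟨z, hz⟩ := (toLower_bijective (f := f)).2 y
  obtain ⟨a, rfl⟩ := hf z
  have ha := LinearMap.congr_fun (map_inclusion_comp_toMiddle (f := f) (n := n)) a
  rw [LinearMap.comp_apply, LinearMap.comp_apply] at ha
  exact ⟨_, ha.trans hz⟩

lemma map_incl_lower_surjective [Nonempty L] (hf : Function.Injective (Homology.map n f)) :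
    Function.Surjective (Homology.map (n + 1) (incl (lower f))) :=
  Homology.map_incl_surjective isOpen_upper isOpen_lower upper_union_lower
    subsingleton_homology_upper (map_inclusion_injective hf)

/-- The homology of the intersection space vanishes where `f` is surjective on homology. -/
lemma subsingleton_homology [Nonempty L] (hf : Function.Injective (Homology.map n f))
    (hf' : Function.Surjective (Homology.map (n + 1) f)) :
    Subsingleton (Homology (n + 1) (IntersectionSpace f)) := by
  refine subsingleton_of_forall_eq 0 fun x ↦ ?_
  obtain ⟨y, rfl⟩ := map_incl_lower_surjective hf x
  -- The class now comes from the intersection, so it also factors through the upper part, whose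
  -- positive homology vanishes.
  obtain ⟨w, rfl⟩ := map_inclusion_surjective hf' y
  have e : Homology.map (n + 1) (incl (lower f)) ∘ₗ
      Homology.map (n + 1) (ContinuousMap.inclusion Set.inter_subset_right) =
    Homology.map (n + 1) (incl (upper f)) ∘ₗ
      Homology.map (n + 1) (ContinuousMap.inclusion Set.inter_subset_left) := by
    rw [← Homology.map_comp, ← Homology.map_comp]
    rfl
  have := subsingleton_homology_upper (f := f) (n := n)
  refine (congr($e w)).trans ?_
  rw [LinearMap.comp_apply, Subsingleton.elim (Homology.map (n + 1) _ w) 0, map_zero]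

/-- The homology of the intersection space is that of `L` where the homology of `A` vanishes. -/
lemma nonempty_homology_equiv [Nonempty L] (hf : Function.Injective (Homology.map n f))
    (hA : Subsingleton (Homology (n + 1) A)) :
    Nonempty (Homology (n + 1) (IntersectionSpace f) ≃ₗ[ℝ] Homology (n + 1) L) := by
  have hW : Subsingleton (Homology (n + 1) (upper f ∩ lower f : Set _)) :=
    (Equiv.ofBijective _ toMiddle_bijective).symm.subsingleton
  exact ⟨((LinearEquiv.ofBijective _ (toLower_bijective (f := f))).trans
    (LinearEquiv.ofBijective (Homology.map (n + 1) (incl (lower f)))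
      ⟨Homology.map_incl_injective isOpen_upper isOpen_lower upper_union_lower hW,
        map_incl_lower_surjective hf⟩)).symm⟩

end IntersectionSpace

theorem theorem4p1 (l : ℕ) (L : Type u) [TopologicalSpace L] [T2Space L]
    [SecondCountableTopology L] [ChartedSpace (EuclideanSpace ℝ (Fin l)) L]
    [IsManifold (𝓡 l) ∞ L] [SimplyConnectedSpace L]
    (p : ExtendedPerversity) (A : Type u) [TopologicalSpace A] (f : C(A, L))
    (hf : IsMooreApproximation ((l : ℤ) - p (l + 1)) f) (j : ℕ) :
    ((0 < j ∧ (j : ℤ) < (l : ℤ) - p (l + 1)) →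
      Subsingleton (ReducedHomology j (IntersectionSpace f))) ∧
    (¬ (0 < j ∧ (j : ℤ) < (l : ℤ) - p (l + 1)) →
      Nonempty (ReducedHomology j (IntersectionSpace f) ≃ₗ[ℝ] ReducedHomology j L)) := by
  obtain _ | n := j
  · refine ⟨fun h ↦ absurd h.1 (lt_irrefl 0), fun _ ↦ ?_⟩
    -- Degree `0` always falls in the second case. Simple connectivity makes `L` path connected, and
    -- the intersection space inherits this.
    have := ReducedHomology.subsingleton_zero (X := L)
    have := ReducedHomology.subsingleton_zero (X := IntersectionSpace f)
    exact ⟨0⟩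
  -- In degree `n + 1` both cases use injectivity of `f` in degree `n`, which holds even at the
  -- cutoff `n + 1 = k`; only the condition in degree `n + 1` itself separates them.
  refine ⟨fun h ↦ ?_, fun h ↦ ?_⟩
  · have := IntersectionSpace.subsingleton_homology (hf.injective n)
      (hf.bijective_of_lt (n + 1) h.2).2
    exact (ReducedHomology.equivHomology n _).toEquiv.subsingleton
  · obtain ⟨e⟩ := IntersectionSpace.nonempty_homology_equiv (hf.injective n)
      (hf.subsingleton_of_le (n + 1) (not_lt.1 fun h' ↦ h ⟨n.succ_pos, h'⟩))
    exact ⟨((ReducedHomology.equivHomology n _).trans e).trans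
      (ReducedHomology.equivHomology n L).symm⟩
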